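/- Let $V=\mathbb C^N$, let $P$ be the flip of $V\otimes V$, and let $q\in\mathbb C\setminus\{0,\pm1\}$ with $q^{2k}\neq1$ for $2\le k\le N$; put $k_q=(q^k-q^{-k})/(q-q^{-1})$. Let $R:V^{\otimes2}\to V^{\otimes 2}$ be a Hecke symmetry, that is, $R_{12}R_{23}R_{12}=R_{23}R_{12}R_{23}$ and $R^2=I+(q-q^{-1})R$. Assume that $R$ is a deformation of $P$: there is a continuous family of Hecke symmetries $R(t)$ with parameters $q(t)\in\mathbb C\setminus\{0\}$, $0\le t\le1$, such that $q(0)=1$, $R(0)=P$, $q(1)=q$, $R(1)=R$, and such that for $t<1$ the parameter is generic: for $2\le k\le N+1$, $q(t)^{2k}=1$ only if $q(t)^2=1$. Assume further that $R$ is skew-invertible, that is, there is an operator $\Psi$ on $V^{\otimes 2}$ with $\mathrm{Tr}_{(2)}R_{12}\Psi_{23}=P_{13}=\mathrm{Tr}_{(2)}\Psi_{12}R_{23}$; put $C=\mathrm{Tr}_{(2)}\Psi_{12}$ and define the $R$-trace by $\mathrm{Tr}_{R(1\dots n)}Y=\mathrm{Tr}\,(C_1\cdots C_n\,Y)$. Write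 $R_k$ for $R$ acting in the factors $k,k+1$ of $V^{\otimes n}$. Let $A^{(1)}=I$ and $A^{(k)}=\frac1{k_q}A^{(k-1)}\bigl(q^{k-1}I-(k-1)_qR_{k-1}\bigr)A^{(k-1)}$ for $k\ge 2$. For a square matrix $X$ of size $N$ put $X_1=X\otimes I$, $X_{\overline1}=X_1$ and $X_{\overline{k+1}}=R_kX_{\overline k}R_k^{-1}$. Consider the unital associative $\mathbb C$-algebra generated by the entries of two $N\times N$ matrices $M$ and $D$ subject to $$R_{12}M_1R_{12}M_1=M_1R_{12}M_1R_{12},\qquad R_{12}^{-1}D_1R_{12}^{-1}D_1=D_1R_{12}^{-1}D_1R_{12}^{-1},$$ $$D_1R_{12}M_1R_{12}=R_{12}M_1R_{12}^{-1}D_1+R_{12},$$ and put $\hat L=MD$. Then $A^{(N)}$ has rank one, and there are $|u\rangle\in V^{\otimes N}$ and $\langle v|\in (V^{\otimes N})^*$ with $A^{(N)}=|u\rangle\langle v|$ and $\langle v|u\rangle=1$. For all such $u$, $v$, with $${\det}_RM=\langle v|M_{\overline1}M_{\overline2}\cdots M_{\overline N}|u\rangle,\qquad {\det}_{R^{-1}}D=\langle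 v|D_{\overline N}\cdots D_{\overline2}D_{\overline1}|u\rangle,$$ the quantum Capelli identity holds: $$\mathrm{Tr}_{R(1\dots N)}\,A^{(N)}\hat L_{\overline1}\bigl(\hat L_{\overline2}+qI\bigr)\cdots\bigl(\hat L_{\overline N}+q^{N-1}(N-1)_qI\bigr)=q^{-N}\,{\det}_RM\;{\det}_{R^{-1}}D .$$ -/

import Mathlib

/-!
Conventions.  `V = ℂ^N`; the space `V^{⊗n}` has the basis indexed by `Fin n → Fin N`, and tensor
factors are numbered from `0` (so the factor called `1` on paper is `0` here).  An operator on
`V ⊗ V` is a matrix indexed by `Fin N × Fin N`.  Matrices may have entries in a noncommutative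
algebra; a product of matrices multiplies the entries in the written order.
-/

namespace Capelli

noncomputable section

variable {N : ℕ} {𝒜 : Type*}

/-- The matrix `X` acting in the `i`-th factor of `V^{⊗n}`. -/
def oneSite [Zero 𝒜] {n : ℕ} (i : Fin n) (X : Matrix (Fin N) (Fin N) 𝒜) :
    Matrix (Fin n → Fin N) (Fin n → Fin N) 𝒜 :=
  Matrix.of fun a b => if ∀ l, l ≠ i → a l = b l then X (a i) (b i) else 0

/-- The matrix `X` acting in the `i`-th and the `j`-th factor of `V^{⊗n}` (`i ≠ j`). -/
def twoSite [Zero 𝒜] {n : ℕ} (i j : Fin n) (X : Matrix (Fin N × Fin N) (Fin N × Fin N) 𝒜) :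
    Matrix (Fin n → Fin N) (Fin n → Fin N) 𝒜 :=
  Matrix.of fun a b =>
    if ∀ l, l ≠ i → l ≠ j → a l = b l then X (a i, a j) (b i, b j) else 0

/-- A numerical matrix regarded as a matrix over a complex algebra. -/
def scalarMat (𝒜 : Type*) [Semiring 𝒜] [Algebra ℂ 𝒜] {ι : Type*} (X : Matrix ι ι ℂ) :
    Matrix ι ι 𝒜 :=
  X.map (algebraMap ℂ 𝒜)

/-- The flip `P (x ⊗ y) = y ⊗ x`. -/
def flip (N : ℕ) : Matrix (Fin N × Fin N) (Fin N × Fin N) ℂ :=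
  Matrix.of fun a b => if a.1 = b.2 ∧ a.2 = b.1 then 1 else 0

/-- `R` satisfies the braid relation and the Hecke condition `R² = I + (q - q⁻¹) R`.
The values `q = ±1` (involutive symmetries) are allowed here. -/
structure IsHeckeSymmetry (q : ℂ) (R : Matrix (Fin N × Fin N) (Fin N × Fin N) ℂ) : Prop where
  ne_zero : q ≠ 0
  braid : twoSite (n := 3) 0 1 R * twoSite 1 2 R * twoSite 0 1 R =
    twoSite 1 2 R * twoSite 0 1 R * twoSite 1 2 R
  hecke : R * R = 1 + (q - q⁻¹) • R

/-- `R` is a deformation of the flip: a continuous family of Hecke symmetries `S t` with parameters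
`p t`, `0 ≤ t ≤ 1`, joins the flip, with the parameter `1`, to `R`, with the parameter `q`.
The parameters before the end of the family are generic: no `q`-integer `k_{p t}`,
`2 ≤ k ≤ N + 1`, vanishes, which means that `(p t)^{2k} = 1` only if `(p t)² = 1`. -/
def IsDeformationOfFlip (q : ℂ) (R : Matrix (Fin N × Fin N) (Fin N × Fin N) ℂ) : Prop :=
  ∃ (p : ℝ → ℂ) (S : ℝ → Matrix (Fin N × Fin N) (Fin N × Fin N) ℂ),
    ContinuousOn p (Set.Icc 0 1) ∧ ContinuousOn S (Set.Icc 0 1) ∧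
    (∀ t ∈ Set.Icc (0 : ℝ) 1, IsHeckeSymmetry (p t) (S t)) ∧
    (∀ t ∈ Set.Ico (0 : ℝ) 1, ∀ k : ℕ, 2 ≤ k → k ≤ N + 1 →
      (p t) ^ (2 * k) = 1 → (p t) ^ 2 = 1) ∧
    p 0 = 1 ∧ S 0 = flip N ∧ p 1 = q ∧ S 1 = R

/-- The `q`-integer `k_q = (q^k - q^{-k}) / (q - q⁻¹)`, for `q ≠ 0, ±1`. -/
def qInt (q : ℂ) (k : ℕ) : ℂ := (q ^ k - (q ^ k)⁻¹) / (q - q⁻¹)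

/-- The `R`-skew-symmetrizer `A^{(k)}` in the first `k` factors of `V^{⊗n}`. -/
def skewSymm (q : ℂ) (R : Matrix (Fin N × Fin N) (Fin N × Fin N) ℂ) (n : ℕ) :
    (k : ℕ) → k ≤ n → Matrix (Fin n → Fin N) (Fin n → Fin N) ℂ
  | 0, _ => 1
  | 1, _ => 1
  | k + 2, h =>
      (qInt q (k + 2))⁻¹ •
        (skewSymm q R n (k + 1) (by omega) *
          (q ^ (k + 1) • (1 : Matrix (Fin n → Fin N) (Fin n → Fin N) ℂ) -
            qInt q (k + 1) • twoSite ⟨k, by omega⟩ ⟨k + 1, by omega⟩ R) *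
          skewSymm q R n (k + 1) (by omega))

/-- `Ψ` is the skew-inverse of `R`: `Tr₂ R₁₂ Ψ₂₃ = P₁₃ = Tr₂ Ψ₁₂ R₂₃`. -/
def IsSkewInverse (R Ψ : Matrix (Fin N × Fin N) (Fin N × Fin N) ℂ) : Prop :=
  (∀ i₁ i₃ j₁ j₃, ∑ a, ∑ b, R (i₁, a) (j₁, b) * Ψ (b, i₃) (a, j₃) = flip N (i₁, i₃) (j₁, j₃)) ∧
  (∀ i₁ i₃ j₁ j₃, ∑ a, ∑ b, Ψ (i₁, a) (j₁, b) * R (b, i₃) (a, j₃) = flip N (i₁, i₃) (j₁, j₃))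

/-- The matrix `C = Tr₂ Ψ₁₂` defining the `R`-trace. -/
def traceMatrix (Ψ : Matrix (Fin N × Fin N) (Fin N × Fin N) ℂ) : Matrix (Fin N) (Fin N) ℂ :=
  Matrix.of fun i j => ∑ a, Ψ (i, a) (j, a)

/-- The `R`-trace `Tr_{R(1…n)} Y = Tr (C₁ ⋯ C_n Y)` over all factors of `V^{⊗n}`, where `Ψ` is the
skew-inverse of `R` and `C = Tr₂ Ψ₁₂`. -/
def rTrace [Semiring 𝒜] [Algebra ℂ 𝒜] (Ψ : Matrix (Fin N × Fin N) (Fin N × Fin N) ℂ) {n : ℕ}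
    (Y : Matrix (Fin n → Fin N) (Fin n → Fin N) 𝒜) : 𝒜 :=
  Matrix.trace
    (scalarMat 𝒜 (Matrix.of fun a b : Fin n → Fin N => ∏ i, traceMatrix Ψ (a i) (b i)) * Y)

/-- The copies `X_{\bar 1} = X_1`, `X_{\overline{k+1}} = R_k X_{\bar k} R_k⁻¹`;
`overlineCopy R X n k` is `X_{\overline{k+1}}` because factors are numbered from `0`. -/
def overlineCopy [Semiring 𝒜] [Algebra ℂ 𝒜] (R : Matrix (Fin N × Fin N) (Fin N × Fin N) ℂ)
    (X : Matrix (Fin N) (Fin N) 𝒜) (n : ℕ) :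
    (k : ℕ) → k < n → Matrix (Fin n → Fin N) (Fin n → Fin N) 𝒜
  | 0, h => oneSite ⟨0, h⟩ X
  | k + 1, h =>
      twoSite ⟨k, by omega⟩ ⟨k + 1, h⟩ (scalarMat 𝒜 R) *
        overlineCopy R X n k (by omega) *
        twoSite ⟨k, by omega⟩ ⟨k + 1, h⟩ (scalarMat 𝒜 R⁻¹)

/-- The generators `m_i^j` and `∂_i^j`. -/
inductive Gen (N : ℕ) : Type
  | m (i j : Fin N) : Gen N
  | d (i j : Fin N) : Gen N

/-- The generating matrix `M` in the free algebra. -/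
def freeM (N : ℕ) : Matrix (Fin N) (Fin N) (FreeAlgebra ℂ (Gen N)) :=
  Matrix.of fun i j => FreeAlgebra.ι ℂ (Gen.m i j)

/-- The generating matrix `D` in the free algebra. -/
def freeD (N : ℕ) : Matrix (Fin N) (Fin N) (FreeAlgebra ℂ (Gen N)) :=
  Matrix.of fun i j => FreeAlgebra.ι ℂ (Gen.d i j)

/-- `M₁` in `V ⊗ V`. -/
abbrev freeM₁ (N : ℕ) := oneSite (n := 2) 0 (freeM N)

/-- `D₁` in `V ⊗ V`. -/
abbrev freeD₁ (N : ℕ) := oneSite (n := 2) 0 (freeD N)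

/-- `X₁₂` in `V ⊗ V`, over the free algebra. -/
abbrev free₁₂ (X : Matrix (Fin N × Fin N) (Fin N × Fin N) ℂ) :=
  twoSite (n := 2) 0 1 (scalarMat (FreeAlgebra ℂ (Gen N)) X)

/-- The defining relations of the quantum double of `𝓓(R⁻¹)` and `𝓜(R)`: the reflection equation
for `M` with `R`, the one for `D` with `R⁻¹`, and the permutation relations. -/
inductive DoubleRel (R : Matrix (Fin N × Fin N) (Fin N × Fin N) ℂ) :
    FreeAlgebra ℂ (Gen N) → FreeAlgebra ℂ (Gen N) → Prop
  | reflM (a b : Fin 2 → Fin N) : DoubleRel R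
      ((free₁₂ R * freeM₁ N * free₁₂ R * freeM₁ N) a b)
      ((freeM₁ N * free₁₂ R * freeM₁ N * free₁₂ R) a b)
  | reflD (a b : Fin 2 → Fin N) : DoubleRel R
      ((free₁₂ R⁻¹ * freeD₁ N * free₁₂ R⁻¹ * freeD₁ N) a b)
      ((freeD₁ N * free₁₂ R⁻¹ * freeD₁ N * free₁₂ R⁻¹) a b)
  | perm (a b : Fin 2 → Fin N) : DoubleRel R
      ((freeD₁ N * free₁₂ R * freeM₁ N * free₁₂ R) a b)
      ((free₁₂ R * freeM₁ N * free₁₂ R⁻¹ * freeD₁ N + free₁₂ R) a b)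

/-- The algebra of the quantum double `(𝓓(R⁻¹), 𝓜(R))`. -/
abbrev QuantumDouble (R : Matrix (Fin N × Fin N) (Fin N × Fin N) ℂ) : Type :=
  RingQuot (DoubleRel R)

/-- The generating matrix `M` of `𝓜(R)` in the quantum double. -/
def matM (R : Matrix (Fin N × Fin N) (Fin N × Fin N) ℂ) :
    Matrix (Fin N) (Fin N) (QuantumDouble R) :=
  (freeM N).map (RingQuot.mkAlgHom ℂ (DoubleRel R))

/-- The generating matrix `D` of `𝓓(R⁻¹)` in the quantum double. -/
def matD (R : Matrix (Fin N × Fin N) (Fin N × Fin N) ℂ) :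
    Matrix (Fin N) (Fin N) (QuantumDouble R) :=
  (freeD N).map (RingQuot.mkAlgHom ℂ (DoubleRel R))

/-- The matrix `\hat L = M D`. -/
def matL (R : Matrix (Fin N × Fin N) (Fin N × Fin N) ℂ) :
    Matrix (Fin N) (Fin N) (QuantumDouble R) :=
  matM R * matD R

/-- `⟨v| Y |u⟩`. -/
def sandwich [Semiring 𝒜] [Algebra ℂ 𝒜] {n : ℕ} (v u : (Fin n → Fin N) → ℂ)
    (Y : Matrix (Fin n → Fin N) (Fin n → Fin N) 𝒜) : 𝒜 :=
  ∑ a, ∑ b, (v a * u b) • Y a b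

/-- `det_R M = ⟨v| M_{\bar 1} M_{\bar 2} ⋯ M_{\bar N} |u⟩`. -/
def detM (R : Matrix (Fin N × Fin N) (Fin N × Fin N) ℂ) (u v : (Fin N → Fin N) → ℂ) :
    QuantumDouble R :=
  sandwich v u (List.ofFn fun k : Fin N => overlineCopy R (matM R) N k k.isLt).prod

/-- `det_{R⁻¹} D = ⟨v| D_{\bar N} ⋯ D_{\bar 2} D_{\bar 1} |u⟩`. -/
def detD (R : Matrix (Fin N × Fin N) (Fin N × Fin N) ℂ) (u v : (Fin N → Fin N) → ℂ) :
    QuantumDouble R :=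
  sandwich v u (List.ofFn fun k : Fin N => overlineCopy R (matD R) N k k.isLt).reverse.prod

/-- `\hat L_{\bar 1} (\hat L_{\bar 2} + q I) ⋯ (\hat L_{\bar N} + q^{N-1} (N-1)_q I)`. -/
def capelliProduct (q : ℂ) (R : Matrix (Fin N × Fin N) (Fin N × Fin N) ℂ) :
    Matrix (Fin N → Fin N) (Fin N → Fin N) (QuantumDouble R) :=
  (List.ofFn fun k : Fin N => overlineCopy R (matL R) N k k.isLt +
    (q ^ (k : ℕ) * qInt q k) •
      (1 : Matrix (Fin N → Fin N) (Fin N → Fin N) (QuantumDouble R))).prod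

end

end Capelli

/-!
In front of an antisymmetric tensor every `R_k` acts as the scalar `-q⁻¹`. The permutation relation
therefore moves a copy of `D` past a copy of `L̂ = M D` at the cost of a scalar, and the scalars
collected by `D_{k̄} ⋯ D_{1̄}` add up to the shift `q ^ k * k_q`. Induction gives
`L̂_{1̄} (L̂_{2̄} + q) ⋯ (L̂_{N̄} + q ^ (N - 1) * (N - 1)_q) A =
  q ^ (N * (N - 1)) • M_{1̄} ⋯ M_{N̄} D_{N̄} ⋯ D_{1̄} A` for `A = A^{(N)}`.

Along the deformation `A^{(N)}` is a continuous family of idempotents, so its trace stays the one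
it has for the flip, namely `1`. In the same way `(N + 1)_q A^{(N + 1)}` vanishes, and its partial
trace yields `Tr C = q ^ (-N) * N_q`; iterated partial traces then give
`Tr_R A^{(N)} = q ^ (-N ^ 2)`. Since `A^{(N)}` has rank one and commutes with `C ⊗ ⋯ ⊗ C` and with
`M_{1̄} ⋯ M_{N̄}`, the `R`-trace factors into this number and the two determinants.
-/

namespace Capelli

section QNumber

variable {K : Type*} [Field K] {q : K}

/-- The `q`-integer `k_q = q^{k-1} + q^{k-3} + ⋯ + q^{1-k}`. Unlike `qInt` it keeps its meaning at
`q = ±1`, which is where a deformation of the flip starts. -/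
def qNum (q : K) : ℕ → K
  | 0 => 0
  | k + 1 => q ^ k + q⁻¹ * qNum q k

@[simp]
theorem qNum_zero (q : K) : qNum q 0 = 0 := rfl

theorem qNum_succ (q : K) (k : ℕ) : qNum q (k + 1) = q ^ k + q⁻¹ * qNum q k := rfl

@[simp]
theorem qNum_one (q : K) : qNum q 1 = 1 := by simp [qNum_succ]

theorem pow_succ_mul_qNum_succ (hq : q ≠ 0) (k : ℕ) :
    q ^ (k + 1) * qNum q (k + 1) = q ^ k * qNum q k + q ^ (2 * k + 1) := by
  rw [qNum_succ]
  field_simp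
  ring

theorem sub_inv_mul_qNum (hq : q ≠ 0) (k : ℕ) : (q - q⁻¹) * qNum q k = q ^ k - (q ^ k)⁻¹ := by
  induction k with
  | zero => simp
  | succ k ih =>
    rw [qNum_succ, mul_add, mul_left_comm, ih, pow_succ]
    field_simp
    ring

theorem qNum_add (hq : q ≠ 0) (k m : ℕ) :
    qNum q (k + m) = q ^ m * qNum q k + (q ^ k)⁻¹ * qNum q m := by
  induction m with
  | zero => simp
  | succ m ih =>
    have hk := sub_inv_mul_qNum hq k
    rw [← add_assoc, qNum_succ, ih, qNum_succ]
    linear_combination -q ^ m * hk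

theorem qInt_eq_qNum {q : ℂ} (hq : q ≠ 0) (hq2 : q ^ 2 ≠ 1) : qInt q = qNum q := by
  have hsub : q - q⁻¹ ≠ 0 := fun h => hq2 <| by
    rw [sq]
    nth_rewrite 2 [sub_eq_zero.mp h]
    exact mul_inv_cancel₀ hq
  ext k
  rw [qInt, ← sub_inv_mul_qNum hq, mul_div_cancel_left₀ _ hsub]

theorem mul_qNum_of_sq_eq_one (hq2 : q ^ 2 = 1) (k : ℕ) : q * qNum q k = k * q ^ k := by
  have hinv : q⁻¹ = q := inv_eq_of_mul_eq_one_left (by rw [← sq, hq2])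
  induction k with
  | zero => simp
  | succ k ih =>
    rw [qNum_succ, hinv, mul_add, ih, ← pow_succ', Nat.cast_succ]
    ring

theorem qNum_ne_zero [CharZero K] (hq : q ≠ 0) {k : ℕ} (hk : k ≠ 0)
    (h : q ^ (2 * k) = 1 → q ^ 2 = 1) : qNum q k ≠ 0 := by
  intro hzero
  have hpow : q ^ k = (q ^ k)⁻¹ := by
    rw [← sub_eq_zero, ← sub_inv_mul_qNum hq, hzero, mul_zero]
  have hq2 : q ^ 2 = 1 := h <| by
    rw [two_mul, pow_add]
    nth_rewrite 2 [hpow]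
    exact mul_inv_cancel₀ (pow_ne_zero k hq)
  have hmul := mul_qNum_of_sq_eq_one hq2 k
  rw [hzero, mul_zero, eq_comm, mul_eq_zero, Nat.cast_eq_zero] at hmul
  exact hmul.elim hk (pow_ne_zero k hq)

end QNumber

section Braid

open ConjAct

/-- The braid relations of `n` strands among `T 0`, …, `T (n - 2)`. -/
structure IsBraidRep {G : Type*} [Monoid G] (n : ℕ) (T : ℕ → G) : Prop where
  braid : ∀ i, i + 2 < n → T i * T (i + 1) * T i = T (i + 1) * T i * T (i + 1)
  comm : ∀ i j, i + 1 < j → j + 1 < n → Commute (T i) (T j)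

variable {E : Type*} [Ring E] {n : ℕ} {T : ℕ → Eˣ} {x : E}

theorem toConjAct_smul_eq_self_iff {u : Eˣ} : toConjAct u • x = x ↔ Commute (u : E) x := by
  rw [units_smul_def, ofConjAct_toConjAct, Units.mul_inv_eq_iff_eq_mul]
  rfl

/-- Conjugation by `T (k - 1) ⋯ T 1 T 0`, which moves the first strand to the place `k`. -/
def strandMove (T : ℕ → Eˣ) : ℕ → ConjAct Eˣ
  | 0 => 1
  | k + 1 => toConjAct (T k) * strandMove T k

/-- The copies `x`, `T₀ x T₀⁻¹`, `T₁ T₀ x T₀⁻¹ T₁⁻¹`, … of an element `x`: the abstract form of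
`overlineCopy`. -/
def copy (T : ℕ → Eˣ) (x : E) (k : ℕ) : E := strandMove T k • x

@[simp]
theorem copy_zero (T : ℕ → Eˣ) (x : E) : copy T x 0 = x := one_smul _ x

theorem copy_succ (T : ℕ → Eˣ) (x : E) (k : ℕ) :
    copy T x (k + 1) = toConjAct (T k) • copy T x k :=
  mul_smul _ _ _

theorem copy_succ_eq_mul (T : ℕ → Eˣ) (x : E) (k : ℕ) :
    copy T x (k + 1) = T k * copy T x k * (T k)⁻¹.1 :=
  copy_succ T x k

theorem copy_mul (T : ℕ → Eˣ) (x y : E) (k : ℕ) : copy T (x * y) k = copy T x k * copy T y k :=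
  smul_mul' _ _ _

theorem copy_add (T : ℕ → Eˣ) (x y : E) (k : ℕ) : copy T (x + y) k = copy T x k + copy T y k :=
  smul_add _ _ _

theorem copy_copy (T : ℕ → Eˣ) (x : E) (k r : ℕ) :
    copy (fun j => T (k + j)) (copy T x k) r = copy T x (k + r) := by
  induction r with
  | zero => rw [copy_zero, add_zero]
  | succ r ih => rw [copy_succ, ih, ← add_assoc, copy_succ]

theorem copy_eq_self {r : ℕ} (h : ∀ j < r, Commute (T j : E) x) : copy T x r = x := by
  induction r with
  | zero => exact copy_zero T x
  | succ r ih =>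
    rw [copy_succ, ih fun j hj => h j (by omega), toConjAct_smul_eq_self_iff]
    exact h r r.lt_succ_self

theorem commute_copy {y : E} {r : ℕ} (hy : Commute y x) (h : ∀ j < r, Commute y (T j)) :
    Commute y (copy T x r) := by
  induction r with
  | zero => rwa [copy_zero]
  | succ r ih =>
    have hr := h r r.lt_succ_self
    rw [copy_succ_eq_mul]
    exact (hr.mul_right (ih fun j hj => h j (by omega))).mul_right hr.units_inv_right

/-- `x` acts in the first of `n` factors: it commutes with the generators of the other strands. -/
def IsFirstFactor (n : ℕ) (T : ℕ → Eˣ) (x : E) : Prop :=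
  ∀ i, 0 < i → i + 1 < n → Commute (T i : E) x

theorem IsBraidRep.commute_copy_of_lt (hT : IsBraidRep n T) (hx : IsFirstFactor n T x) {k i : ℕ}
    (hk : k < i) (hi : i + 1 < n) : Commute (T i : E) (copy T x k) :=
  commute_copy (hx i (by omega) hi) fun j hj => ((hT.comm j i (by omega) hi).symm).units_val

theorem IsBraidRep.commute_copy_add_two (hT : IsBraidRep n T) (hx : IsFirstFactor n T x) {i : ℕ}
    (hi : i + 2 < n) : Commute (T i : E) (copy T x (i + 2)) := by
  have hfix : toConjAct (T (i + 1)) • copy T x i = copy T x i :=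
    toConjAct_smul_eq_self_iff.mpr (hT.commute_copy_of_lt hx i.lt_succ_self hi)
  rw [← toConjAct_smul_eq_self_iff]
  calc toConjAct (T i) • copy T x (i + 2)
      = toConjAct (T i * T (i + 1) * T i) • copy T x i := by
        rw [copy_succ, copy_succ, map_mul, map_mul, mul_smul, mul_smul]
    _ = toConjAct (T (i + 1)) • toConjAct (T i) • toConjAct (T (i + 1)) • copy T x i := by
        rw [hT.braid i hi, map_mul, map_mul, mul_smul, mul_smul]
    _ = copy T x (i + 2) := by rw [hfix, copy_succ, copy_succ]

theorem IsBraidRep.commute_copy_of_add_two_le (hT : IsBraidRep n T) (hx : IsFirstFactor n T x)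
    {k i : ℕ} (hi : i + 2 ≤ k) (hk : k < n) : Commute (T i : E) (copy T x k) := by
  obtain ⟨r, rfl⟩ := Nat.exists_eq_add_of_le hi
  rw [← copy_copy]
  exact commute_copy (hT.commute_copy_add_two hx (by omega)) fun j hj =>
    (hT.comm i _ (by omega) (by omega)).units_val

theorem IsBraidRep.commute_copy_of_ne (hT : IsBraidRep n T) (hx : IsFirstFactor n T x) {k i : ℕ}
    (hk : k < n) (hi : i + 1 < n) (hki : k ≠ i) (hki' : k ≠ i + 1) :
    Commute (T i : E) (copy T x k) := by
  rcases lt_or_gt_of_ne hki with hlt | hgt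
  · exact hT.commute_copy_of_lt hx hlt hi
  · exact hT.commute_copy_of_add_two_le hx (by omega) hk

/-- As the same `g` serves `T 0` and all first factors, every relation between them is moved to the
place `k`. -/
theorem IsBraidRep.exists_smul_eq (hT : IsBraidRep n T) {k : ℕ} (hk : k + 1 < n) :
    ∃ g : ConjAct Eˣ, g • (T 0 : E) = T k ∧ g • ((T 0)⁻¹.1 : E) = (T k)⁻¹.1 ∧
      ∀ x : E, IsFirstFactor n T x → g • x = copy T x k := by
  induction k with
  | zero => exact ⟨1, one_smul _ _, one_smul _ _, fun x _ => rfl⟩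
  | succ k ih =>
    obtain ⟨g, hg, hg', hgx⟩ := ih (by omega)
    have hconj : T k * T (k + 1) * T k * (T k * T (k + 1))⁻¹ = T (k + 1) := by
      rw [hT.braid k hk, mul_assoc (T (k + 1)), mul_inv_cancel_right]
    refine ⟨toConjAct (T k * T (k + 1)) * g, ?_, ?_, fun x hx => ?_⟩
    · rw [mul_smul, hg]
      exact congrArg Units.val hconj
    · rw [mul_smul, hg']
      exact congrArg Units.val (conj_inv.symm.trans (congrArg _ hconj))
    · rw [mul_smul, hgx x hx, map_mul, mul_smul, toConjAct_smul_eq_self_iff.mpr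
        (hT.commute_copy_of_lt hx k.lt_succ_self hk), copy_succ]

theorem IsBraidRep.commute_copy_mul_copy_succ (hT : IsBraidRep n T) (hx : IsFirstFactor n T x)
    (h : Commute (T 0 : E) (x * copy T x 1)) {k : ℕ} (hk : k + 1 < n) :
    Commute (T k : E) (copy T x k * copy T x (k + 1)) := by
  obtain ⟨g, hg, hg', hgx⟩ := hT.exists_smul_eq hk
  simpa only [MulSemiringAction.toRingHom_apply, smul_mul', hg, hg', hgx x hx, copy_succ_eq_mul,
    copy_zero] using h.map (MulSemiringAction.toRingHom _ E g)

theorem IsBraidRep.commute_copy_succ_mul_copy (hT : IsBraidRep n T) (hx : IsFirstFactor n T x)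
    (h : Commute (T 0 : E) (copy T x 1 * x)) {k : ℕ} (hk : k + 1 < n) :
    Commute (T k : E) (copy T x (k + 1) * copy T x k) := by
  obtain ⟨g, hg, hg', hgx⟩ := hT.exists_smul_eq hk
  simpa only [MulSemiringAction.toRingHom_apply, smul_mul', hg, hg', hgx x hx, copy_succ_eq_mul,
    copy_zero] using h.map (MulSemiringAction.toRingHom _ E g)

end Braid

section OrderedProduct

variable {E : Type*} [Monoid E]

/-- The increasing product `f 0 * f 1 * ⋯ * f (k - 1)`. -/
def incProd (f : ℕ → E) : ℕ → E
  | 0 => 1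
  | k + 1 => incProd f k * f k

/-- The decreasing product `f (k - 1) * ⋯ * f 1 * f 0`. -/
def decProd (f : ℕ → E) : ℕ → E
  | 0 => 1
  | k + 1 => f k * decProd f k

theorem op_decProd (f : ℕ → E) (k : ℕ) :
    MulOpposite.op (decProd f k) = incProd (fun j => MulOpposite.op (f j)) k := by
  induction k with
  | zero => rfl
  | succ k ih => rw [decProd, incProd, MulOpposite.op_mul, ih]

theorem prod_ofFn_eq_incProd (f : ℕ → E) (n : ℕ) :
    (List.ofFn fun k : Fin n => f k).prod = incProd f n := by
  induction n with
  | zero => rfl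
  | succ n ih =>
    rw [List.ofFn_succ_last, List.prod_append, List.prod_singleton, incProd, ← ih]
    rfl

theorem prod_reverse_ofFn_eq_decProd (f : ℕ → E) (n : ℕ) :
    (List.ofFn fun k : Fin n => f k).reverse.prod = decProd f n := by
  induction n with
  | zero => rfl
  | succ n ih =>
    rw [List.ofFn_succ_last, List.reverse_append, List.prod_append, List.reverse_singleton,
      List.prod_singleton, decProd, ← ih]
    rfl

theorem commute_incProd {t : E} {f : ℕ → E} {i k : ℕ} (hik : i + 1 ≠ k)
    (hfar : ∀ j < k, j ≠ i → j ≠ i + 1 → Commute t (f j))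
    (hnear : i + 1 < k → Commute t (f i * f (i + 1))) : Commute t (incProd f k) := by
  induction k using Nat.twoStepInduction with
  | zero => exact Commute.one_right t
  | one => exact (Commute.one_right t).mul_right (hfar 0 one_pos (by omega) (by omega))
  | more k ih ih' =>
    rcases eq_or_ne k i with rfl | hki
    · rw [incProd, incProd, mul_assoc]
      exact (ih (by omega) (fun j hj => hfar j (by omega)) (by omega)).mul_right
        (hnear (by omega))
    · exact (ih' (by omega) (fun j hj => hfar j (by omega)) fun h => hnear (by omega)).mul_right
        (hfar _ (by omega) (by omega) (by omega))

theorem commute_decProd {t : E} {f : ℕ → E} {i k : ℕ} (hik : i + 1 ≠ k)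
    (hfar : ∀ j < k, j ≠ i → j ≠ i + 1 → Commute t (f j))
    (hnear : i + 1 < k → Commute t (f (i + 1) * f i)) : Commute t (decProd f k) := by
  refine Commute.unop (x := MulOpposite.op t) (y := MulOpposite.op (decProd f k)) ?_
  rw [op_decProd]
  exact commute_incProd hik (fun j hj h h' => (hfar j hj h h').op) fun h => (hnear h).op

end OrderedProduct

section Double

variable {K E : Type*} [Field K] [Ring E] [Algebra K E] {n : ℕ} {T : ℕ → Eˣ} {m d b : E} {q : K}

theorem units_inv_mul_of_eigen {a : K} (ha : a ≠ 0) {u : Eˣ} (h : (u : E) * b = a • b) :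
    u⁻¹.1 * b = a⁻¹ • b := by
  rw [Units.inv_mul_eq_iff_eq_mul, mul_smul_comm, h, inv_smul_smul₀ ha]

theorem copy_mul_of_eigen {a c : K} (ha : a ≠ 0) {x : E} {r : ℕ}
    (hT : ∀ j < r, (T j : E) * b = a • b) (hx : x * b = c • b) : copy T x r * b = c • b := by
  induction r with
  | zero => rwa [copy_zero]
  | succ r ih =>
    have hr := hT r r.lt_succ_self
    rw [copy_succ_eq_mul, mul_assoc, mul_assoc, units_inv_mul_of_eigen ha hr, mul_smul_comm,
      mul_smul_comm, ih fun j hj => hT j (by omega), mul_smul_comm, hr, smul_comm c,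
      inv_smul_smul₀ ha]

theorem commute_mul_of_eigen {a : K} {x y : E} (h : Commute x y) (hx : x * b = a • b) :
    x * (y * b) = a • (y * b) := by
  rw [← mul_assoc, h.eq, mul_assoc, hx, mul_smul_comm]

/-- The relations of the quantum double for elements `m`, `d` of an algebra in which the braid group
acts through `T`; `m` and `d` play the roles of `M₁` and `D₁`. -/
structure IsDouble (n : ℕ) (T : ℕ → Eˣ) (m d : E) : Prop where
  rep : IsBraidRep n T
  first_m : IsFirstFactor n T m
  first_d : IsFirstFactor n T d
  refl_m : 1 < n → (T 0 : E) * m * T 0 * m = m * T 0 * m * T 0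
  refl_d : 1 < n → (T 0)⁻¹.1 * d * (T 0)⁻¹.1 * d = d * (T 0)⁻¹.1 * d * (T 0)⁻¹.1
  perm : 1 < n → d * T 0 * m * T 0 = T 0 * m * (T 0)⁻¹.1 * d + T 0

namespace IsDouble

theorem first_mul (h : IsDouble n T m d) : IsFirstFactor n T (m * d) := fun i h0 hi =>
  (h.first_m i h0 hi).mul_right (h.first_d i h0 hi)

theorem commute_incProd_copy (h : IsDouble n T m d) {i k : ℕ} (hi : i + 1 < n) (hk : k ≤ n)
    (hik : i + 1 ≠ k) : Commute (T i : E) (incProd (copy T m) k) := by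
  refine commute_incProd hik (fun j hj hji hji' => h.rep.commute_copy_of_ne h.first_m (by omega)
    hi hji hji') fun _ => h.rep.commute_copy_mul_copy_succ h.first_m ?_ hi
  have := congrArg (· * (T 0)⁻¹.1) (h.refl_m (by omega))
  simpa [Commute, SemiconjBy, copy_succ_eq_mul, mul_assoc] using this

theorem commute_decProd_copy (h : IsDouble n T m d) {i k : ℕ} (hi : i + 1 < n) (hk : k ≤ n)
    (hik : i + 1 ≠ k) : Commute (T i : E) (decProd (copy T d) k) := by
  refine commute_decProd hik (fun j hj hji hji' => h.rep.commute_copy_of_ne h.first_d (by omega)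
    hi hji hji') fun _ => h.rep.commute_copy_succ_mul_copy h.first_d ?_ hi
  have := congrArg (fun z => (T 0 : E) * (T 0 * z) * T 0) (h.refl_d (by omega))
  simpa [Commute, SemiconjBy, copy_succ_eq_mul, mul_assoc] using this.symm

theorem mul_copy_one (h : IsDouble n T m d) (hn : 1 < n) : d * copy T (m * d) 1 =
    copy T (m * d) 1 * d * (T 0)⁻¹.1 * (T 0)⁻¹.1 + d * (T 0)⁻¹.1 := by
  have hm : d * copy T m 1 = copy T m 1 * d * (T 0)⁻¹.1 * (T 0)⁻¹.1 + (T 0)⁻¹.1 := by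
    have := congrArg (· * (T 0)⁻¹.1 * (T 0)⁻¹.1) (h.perm hn)
    simpa [copy_succ_eq_mul, mul_assoc, add_mul] using this
  have hd : d * (T 0)⁻¹.1 * (T 0)⁻¹.1 * copy T d 1 = copy T d 1 * d * (T 0)⁻¹.1 * (T 0)⁻¹.1 := by
    have := congrArg (fun z => (T 0 : E) * z * (T 0)⁻¹.1) (h.refl_d hn)
    simpa [copy_succ_eq_mul, mul_assoc] using this
  calc d * copy T (m * d) 1 = d * copy T m 1 * copy T d 1 := by rw [copy_mul, mul_assoc]
    _ = copy T m 1 * (d * (T 0)⁻¹.1 * (T 0)⁻¹.1 * copy T d 1) + (T 0)⁻¹.1 * copy T d 1 := by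
      rw [hm]; simp only [add_mul, mul_assoc]
    _ = copy T (m * d) 1 * d * (T 0)⁻¹.1 * (T 0)⁻¹.1 + d * (T 0)⁻¹.1 := by
      rw [hd]
      simp only [copy_succ_eq_mul, copy_zero, mul_assoc, Units.inv_mul_cancel_left]

theorem copy_mul_copy_succ (h : IsDouble n T m d) {i : ℕ} (hi : i + 1 < n) :
    copy T d i * copy T (m * d) (i + 1) =
      copy T (m * d) (i + 1) * copy T d i * (T i)⁻¹.1 * (T i)⁻¹.1 + copy T d i * (T i)⁻¹.1 := by
  obtain ⟨g, hg, hg', hgx⟩ := h.rep.exists_smul_eq hi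
  simpa only [smul_mul', smul_add, hg, hg', hgx d h.first_d, hgx _ h.first_mul, copy_succ_eq_mul,
    copy_zero] using congrArg (g • ·) (h.mul_copy_one (by omega))

theorem copy_mul_copy_of_lt (h : IsDouble n T m d) {i r : ℕ} (hr : i + 1 + r < n) :
    let J := copy (fun j => T (i + 1 + j)) (T i)⁻¹.1 r
    copy T d i * copy T (m * d) (i + 1 + r) =
      copy T (m * d) (i + 1 + r) * copy T d i * J * J + copy T d i * J := by
  have hd : copy (fun j => T (i + 1 + j)) (copy T d i) r = copy T d i :=
    copy_eq_self fun j hj => h.rep.commute_copy_of_lt h.first_d (by omega) (by omega)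
  have := congrArg (fun z => copy (fun j => T (i + 1 + j)) z r)
    (h.copy_mul_copy_succ (i := i) (by omega))
  simpa only [copy_mul, copy_add, copy_copy, hd] using this

theorem copy_mul_copy_mul_of_eigen (h : IsDouble n T m d) (hq : q ≠ 0) {i k : ℕ} (hik : i < k)
    (hk : k < n) (hb : ∀ j, i ≤ j → j < k → (T j : E) * b = (-q⁻¹) • b) :
    copy T d i * copy T (m * d) k * b =
      q ^ 2 • (copy T (m * d) k * (copy T d i * b)) - q • (copy T d i * b) := by
  obtain ⟨r, rfl⟩ := Nat.exists_eq_add_of_le hik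
  have hq' : -q⁻¹ ≠ 0 := neg_ne_zero.mpr (inv_ne_zero hq)
  have hJ : copy (fun j => T (i + 1 + j)) (T i)⁻¹.1 r * b = (-q⁻¹)⁻¹ • b :=
    copy_mul_of_eigen hq' (fun j hj => hb _ (by omega) (by omega))
      (units_inv_mul_of_eigen hq' (hb i le_rfl (by omega)))
  rw [h.copy_mul_copy_of_lt hk]
  simp only [add_mul, mul_assoc, hJ, mul_smul_comm, smul_smul]
  match_scalars <;> field_simp

theorem decProd_mul_copy_mul (h : IsDouble n T m d) (hq : q ≠ 0) {i k : ℕ} (hik : i ≤ k)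
    (hk : k < n) (hb : ∀ j < k, (T j : E) * b = (-q⁻¹) • b) :
    decProd (copy T d) i * (copy T (m * d) k * b) =
      q ^ (2 * i) • (copy T (m * d) k * (decProd (copy T d) i * b)) -
        (q ^ i * qNum q i) • (decProd (copy T d) i * b) := by
  induction i with
  | zero => simp [decProd]
  | succ i ih =>
    have hstep := h.copy_mul_copy_mul_of_eigen hq hik hk fun j hij hj =>
      commute_mul_of_eigen (h.commute_decProd_copy (k := i) (by omega) (by omega) (by omega))
        (hb j hj)
    rw [mul_assoc] at hstep
    rw [decProd, mul_assoc, ih (by omega), mul_sub, mul_smul_comm, mul_smul_comm, hstep,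
      pow_succ_mul_qNum_succ hq, ← mul_assoc (copy T d i)]
    module

theorem capelli (h : IsDouble n T m d) (hq : q ≠ 0) {k : ℕ} (hk : k ≤ n)
    (hb : ∀ j, j + 1 < k → (T j : E) * b = (-q⁻¹) • b) :
    incProd (fun j => copy T (m * d) j + (q ^ j * qNum q j) • 1) k * b =
      q ^ (k * (k - 1)) • (incProd (copy T m) k * (decProd (copy T d) k * b)) := by
  induction k generalizing b with
  | zero => simp [incProd, decProd]
  | succ k ih =>
    set L := copy T (m * d) k with hL
    set s := q ^ k * qNum q k
    have hb' : ∀ j, j + 1 < k → (T j : E) * ((L + s • 1) * b) = (-q⁻¹) • ((L + s • 1) * b) := by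
      intro j hj
      have hjL : Commute (T j : E) L :=
        h.rep.commute_copy_of_add_two_le h.first_mul (by omega) (by omega)
      exact commute_mul_of_eigen (hjL.add_right ((Commute.one_right _).smul_right s))
        (hb j (by omega))
    have hmove : decProd (copy T d) k * ((L + s • 1) * b) =
        q ^ (2 * k) • (L * (decProd (copy T d) k * b)) := by
      rw [add_mul, smul_mul_assoc, one_mul, mul_add, mul_smul_comm,
        h.decProd_mul_copy_mul hq le_rfl (by omega) fun j hj => hb j (by omega), sub_add_cancel]
    have hexp : (k + 1) * (k + 1 - 1) = k * (k - 1) + 2 * k := by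
      cases k with
      | zero => rfl
      | succ k => simp only [Nat.add_sub_cancel]; ring
    rw [incProd, mul_assoc, ih (by omega) hb', hmove, mul_smul_comm, smul_smul, ← pow_add, ← hexp,
      hL, copy_mul, incProd, decProd]
    simp only [mul_assoc]

end IsDouble

end Double

section Hecke

variable {K E : Type*} [Field K] [Ring E] [Algebra K E] {n k : ℕ} {q : K} {T : ℕ → E}

/-- The `q`-integers `2_q`, …, `k_q` are nonzero, so that the antisymmetrizers of up to `k` factors
exist. -/
def IsRegular (q : K) (k : ℕ) : Prop := ∀ j, 2 ≤ j → j ≤ k → qNum q j ≠ 0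

theorem IsRegular.mono {k' : ℕ} (h : IsRegular q k) (hk : k' ≤ k) : IsRegular q k' :=
  fun j h2 hj => h j h2 (hj.trans hk)

/-- A representation of the Hecke algebra `H_n(q)`. -/
structure IsHeckeRep (n : ℕ) (q : K) (T : ℕ → E) : Prop extends IsBraidRep n T where
  hecke : ∀ i, i + 1 < n → T i * T i = 1 + (q - q⁻¹) • T i

/-- The antisymmetrizers of a representation `T` of the Hecke algebra: the abstract form of
`skewSymm`. -/
def skewElem (q : K) (T : ℕ → E) : ℕ → E
  | 0 => 1
  | 1 => 1
  | k + 2 => (qNum q (k + 2))⁻¹ • (skewElem q T (k + 1) *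
      (q ^ (k + 1) • 1 - qNum q (k + 1) • T k) * skewElem q T (k + 1))

@[simp]
theorem skewElem_one (q : K) (T : ℕ → E) : skewElem q T 1 = 1 := rfl

theorem skewElem_add_two (q : K) (T : ℕ → E) (k : ℕ) :
    skewElem q T (k + 2) = (qNum q (k + 2))⁻¹ • (skewElem q T (k + 1) *
      (q ^ (k + 1) • 1 - qNum q (k + 1) • T k) * skewElem q T (k + 1)) :=
  rfl

theorem skewElem_congr {T' : ℕ → E} (h : ∀ i, i + 1 < k → T i = T' i) :
    skewElem q T k = skewElem q T' k := by
  induction k using Nat.twoStepInduction with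
  | zero | one => rfl
  | more k _ ih =>
    rw [skewElem_add_two, skewElem_add_two, ih fun i hi => h i (by omega), h k (by omega)]

/-- The Yang–Baxter equation of the baxterized generators, at the spectral parameter where the
outer factor is proportional to a projector. -/
theorem baxter_mul {x y : E} (hq : q ≠ 0) (hxy : x * y * x = y * x * y)
    (hx : x * x = 1 + (q - q⁻¹) • x) (hy : y * y = 1 + (q - q⁻¹) • y) (k : ℕ) :
    (x + q⁻¹ • 1) * (q ^ k • 1 - qNum q k • y) * (q ^ (k + 1) • 1 - qNum q (k + 1) • x) =
      (q ^ (k + 1) • 1 - qNum q (k + 1) • y) * (q ^ k • 1 - qNum q k • x) * (y + q⁻¹ • 1) := by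
  simp only [mul_add, add_mul, mul_sub, sub_mul, smul_mul_assoc, mul_smul_comm, one_mul, mul_one,
    smul_add, smul_sub, smul_smul, hxy, hx, hy, qNum_succ, pow_succ]
  match_scalars <;> field_simp <;> ring

theorem commute_smul_one_sub_smul {x y : E} (h : Commute x y) (a b : K) :
    Commute x (a • 1 - b • y) :=
  ((Commute.one_right x).smul_right a).sub_right (h.smul_right b)

theorem commute_skewElem {x : E} (h : ∀ i, i + 1 < k → Commute x (T i)) :
    Commute x (skewElem q T k) := by
  induction k using Nat.twoStepInduction with
  | zero | one => exact Commute.one_right x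
  | more k _ ih =>
    have hA := ih fun i hi => h i (by omega)
    have hX := commute_smul_one_sub_smul (h k (by omega)) (q ^ (k + 1)) (qNum q (k + 1))
    exact ((hA.mul_right hX).mul_right hA).smul_right _

theorem skewElem_mul_of_eigen {b : E} (hreg : IsRegular q k)
    (hb : ∀ i, i + 1 < k → T i * b = (-q⁻¹) • b) : skewElem q T k * b = b := by
  induction k using Nat.twoStepInduction with
  | zero | one => exact one_mul b
  | more k _ ih =>
    have hA : skewElem q T (k + 1) * b = b :=
      ih (hreg.mono (by omega)) fun i hi => hb i (by omega)
    have hX : (q ^ (k + 1) • (1 : E) - qNum q (k + 1) • T k) * b = qNum q (k + 2) • b := by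
      rw [sub_mul, smul_mul_assoc, smul_mul_assoc, one_mul, hb k (by omega), qNum_succ q (k + 1)]
      module
    rw [skewElem_add_two, smul_mul_assoc, mul_assoc, hA, mul_assoc, hX, mul_smul_comm, hA,
      inv_smul_smul₀ (hreg _ (by omega) le_rfl)]

theorem mul_eq_neg_inv_smul_iff {x y : E} :
    x * y = (-q⁻¹) • y ↔ (x + q⁻¹ • 1) * y = 0 := by
  rw [add_mul, smul_mul_assoc, one_mul, neg_smul, eq_neg_iff_add_eq_zero]

namespace IsHeckeRep

/-- `baxter_mul` moves the annihilating factor `T k + q⁻¹` on the left to a factor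
`T (k - 1) + q⁻¹` on the right. -/
theorem add_mul_skewElem_mul_mul (h : IsHeckeRep n q T) (hq : q ≠ 0) (hk : k + 1 < n)
    (hreg : IsRegular q (k + 1))
    (ih : ∀ i, i < k → T i * skewElem q T (k + 1) = (-q⁻¹) • skewElem q T (k + 1)) :
    (T k + q⁻¹ • 1) * (skewElem q T (k + 1) *
      (q ^ (k + 1) • 1 - qNum q (k + 1) • T k) * skewElem q T (k + 1)) = 0 := by
  cases k with
  | zero =>
    have hT := h.hecke 0 hk
    simp only [skewElem_one, zero_add, pow_one, qNum_one, one_smul, one_mul, mul_one, mul_sub,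
      add_mul, mul_smul_comm, smul_mul_assoc, hT]
    match_scalars <;> field_simp <;> ring
  | succ j =>
    set A := skewElem q T (j + 2)
    set B := skewElem q T (j + 1)
    set X := q ^ (j + 2) • (1 : E) - qNum q (j + 2) • T (j + 1)
    set Y := q ^ (j + 1) • (1 : E) - qNum q (j + 1) • T j
    have hA : A = (qNum q (j + 2))⁻¹ • (B * Y * B) := skewElem_add_two q T j
    have hTB : Commute (T (j + 1)) B :=
      commute_skewElem fun i hi => (h.comm i (j + 1) (by omega) hk).symm
    have hZB : Commute (T (j + 1) + q⁻¹ • 1) B :=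
      hTB.add_left ((Commute.one_left _).smul_left _)
    have hBX : Commute B X := commute_smul_one_sub_smul hTB.symm _ _
    have hBA : B * A = A := skewElem_mul_of_eigen (hreg.mono (by omega)) fun i hi => ih i (by omega)
    have hWA : (T j + q⁻¹ • 1) * A = 0 := mul_eq_neg_inv_smul_iff.mp (ih j (by omega))
    have hbaxter := baxter_mul hq (h.braid j hk).symm (h.hecke (j + 1) hk)
      (h.hecke j (by omega)) (j + 1)
    calc (T (j + 1) + q⁻¹ • 1) * (A * X * A)
        = (qNum q (j + 2))⁻¹ • (((T (j + 1) + q⁻¹ • 1) * B) * Y * (B * X) * A) := by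
          nth_rewrite 1 [hA]
          simp only [smul_mul_assoc, mul_smul_comm, mul_assoc]
      _ = (qNum q (j + 2))⁻¹ • (B * ((T (j + 1) + q⁻¹ • 1) * Y * X) * (B * A)) := by
          rw [hZB.eq, hBX.eq]
          simp only [mul_assoc]
      _ = 0 := by rw [hbaxter, hBA, mul_assoc B, mul_assoc, hWA, mul_zero, mul_zero, smul_zero]

theorem mul_skewElem (h : IsHeckeRep n q T) (hq : q ≠ 0) (hk : k ≤ n) (hreg : IsRegular q k) {i : ℕ}
    (hi : i + 1 < k) : T i * skewElem q T k = (-q⁻¹) • skewElem q T k := by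
  induction k using Nat.twoStepInduction generalizing i with
  | zero | one => omega
  | more k _ ih =>
    replace ih {i : ℕ} (hi : i < k) := ih (i := i) (by omega) (hreg.mono (by omega)) (by omega)
    rw [skewElem_add_two, mul_smul_comm, smul_comm]
    congr 1
    rcases eq_or_lt_of_le (show i ≤ k by omega) with rfl | hik
    · exact mul_eq_neg_inv_smul_iff.mpr
        (h.add_mul_skewElem_mul_mul hq hk (hreg.mono (by omega)) fun _ hj => ih hj)
    · rw [← mul_assoc, ← mul_assoc, ih hik, smul_mul_assoc, smul_mul_assoc]

theorem skewElem_mul_self (h : IsHeckeRep n q T) (hq : q ≠ 0) (hk : k ≤ n) (hreg : IsRegular q k) :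
    skewElem q T k * skewElem q T k = skewElem q T k :=
  skewElem_mul_of_eigen hreg fun _ hi => h.mul_skewElem hq hk hreg hi

theorem op (h : IsHeckeRep n q T) : IsHeckeRep n q fun i => MulOpposite.op (T i) where
  braid i hi := by
    simpa only [MulOpposite.op_mul, mul_assoc] using congrArg MulOpposite.op (h.braid i hi)
  comm i j hij hj := (h.comm i j hij hj).op
  hecke i hi := congrArg MulOpposite.op (h.hecke i hi)

end IsHeckeRep

theorem op_skewElem (k : ℕ) :
    MulOpposite.op (skewElem q T k) = skewElem q (fun i => MulOpposite.op (T i)) k := by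
  induction k using Nat.twoStepInduction with
  | zero | one => rfl
  | more k _ ih =>
    simp only [skewElem_add_two, ← ih, ← mul_assoc, MulOpposite.op_smul, MulOpposite.op_mul,
      MulOpposite.op_sub, MulOpposite.op_one]

theorem IsHeckeRep.skewElem_mul (h : IsHeckeRep n q T) (hq : q ≠ 0) (hk : k ≤ n)
    (hreg : IsRegular q k) {i : ℕ} (hi : i + 1 < k) :
    skewElem q T k * T i = (-q⁻¹) • skewElem q T k := by
  have := h.op.mul_skewElem hq hk hreg hi
  rw [← op_skewElem] at this
  exact MulOpposite.op_injective this

theorem map_skewElem {F : Type*} [Ring F] [Algebra K F] (φ : E →ₐ[K] F) (q : K) (T : ℕ → E)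
    (k : ℕ) : φ (skewElem q T k) = skewElem q (fun i => φ (T i)) k := by
  induction k using Nat.twoStepInduction with
  | zero | one => exact map_one φ
  | more k _ ih => simp only [skewElem_add_two, map_smul, map_mul, map_sub, map_one, ih]

end Hecke

section Sites

variable {N m n : ℕ} {𝒜 : Type*}

/-- The matrix `X` acting in the factors `f 0`, `f 1`, … of `V^{⊗n}`, meant for injective `f`: the
common generalization of `oneSite` and `twoSite`. -/
def sites [Zero 𝒜] (f : Fin m → Fin n) (X : Matrix (Fin m → Fin N) (Fin m → Fin N) 𝒜) :
    Matrix (Fin n → Fin N) (Fin n → Fin N) 𝒜 :=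
  Matrix.of fun a b => if ∀ l, (∀ k, f k ≠ l) → a l = b l then X (a ∘ f) (b ∘ f) else 0

theorem sites_apply [Zero 𝒜] (f : Fin m → Fin n) (X : Matrix (Fin m → Fin N) (Fin m → Fin N) 𝒜)
    (a b : Fin n → Fin N) : sites f X a b =
      if ∀ l, (∀ k, f k ≠ l) → a l = b l then X (a ∘ f) (b ∘ f) else 0 := rfl

theorem extend_apply_of_forall_ne {f : Fin m → Fin n} {l : Fin n} (hl : ∀ k, f k ≠ l)
    (p : Fin m → Fin N) (a : Fin n → Fin N) : Function.extend f p a l = a l :=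
  Function.extend_apply' _ _ _ fun ⟨k, hk⟩ => hl k hk

theorem extend_comp_eq {f : Fin m → Fin n} (hf : Function.Injective f) {a b : Fin n → Fin N}
    (h : ∀ l, (∀ k, f k ≠ l) → a l = b l) : Function.extend f (a ∘ f) b = a := by
  ext l
  by_cases hl : ∃ k, f k = l
  · obtain ⟨k, rfl⟩ := hl
    rw [hf.extend_apply, Function.comp_apply]
  · rw [Function.extend_apply' _ _ _ hl, h l (not_exists.mp hl)]

section Mul

variable [NonUnitalNonAssocSemiring 𝒜] {f : Fin m → Fin n} (hf : Function.Injective f)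
  (X : Matrix (Fin m → Fin N) (Fin m → Fin N) 𝒜) (Y : Matrix (Fin n → Fin N) (Fin n → Fin N) 𝒜)
include hf

theorem mul_sites_apply (a b : Fin n → Fin N) :
    (Y * sites f X) a b = ∑ p, Y a (Function.extend f p b) * X p (b ∘ f) := by
  rw [Matrix.mul_apply]
  refine (Fintype.sum_of_injective _ (Function.extend_injective hf b) _ _ ?_ ?_).symm
  · intro c hc
    rw [sites_apply, if_neg fun h => hc ⟨c ∘ f, extend_comp_eq hf h⟩, mul_zero]
  · intro p
    rw [sites_apply, if_pos fun l hl => extend_apply_of_forall_ne hl p b, Function.extend_comp hf]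

theorem sites_mul_apply (a b : Fin n → Fin N) :
    (sites f X * Y) a b = ∑ p, X (a ∘ f) p * Y (Function.extend f p a) b := by
  rw [Matrix.mul_apply]
  refine (Fintype.sum_of_injective _ (Function.extend_injective hf a) _ _ ?_ ?_).symm
  · intro c hc
    rw [sites_apply, if_neg fun h => hc ⟨c ∘ f, extend_comp_eq hf fun l hl => (h l hl).symm⟩,
      zero_mul]
  · intro p
    rw [sites_apply, if_pos fun l hl => (extend_apply_of_forall_ne hl p a).symm,
      Function.extend_comp hf]

theorem sites_mul (X' : Matrix (Fin m → Fin N) (Fin m → Fin N) 𝒜) :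
    sites f (X * X') = sites f X * sites f X' := by
  ext a b
  rw [mul_sites_apply hf, sites_apply]
  split_ifs with h
  · refine Finset.sum_congr rfl fun p _ => ?_
    rw [sites_apply, Function.extend_comp hf, if_pos fun l hl => ?_]
    rw [extend_apply_of_forall_ne hl, h l hl]
  · refine (Finset.sum_eq_zero fun p _ => ?_).symm
    rw [sites_apply, if_neg, zero_mul]
    exact fun h' => h fun l hl => (h' l hl).trans (extend_apply_of_forall_ne hl p b)

end Mul

theorem sites_one [Zero 𝒜] [One 𝒜] {f : Fin m → Fin n} (hf : Function.Injective f) :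
    sites f (1 : Matrix (Fin m → Fin N) (Fin m → Fin N) 𝒜) = 1 := by
  ext a b
  rw [sites_apply, Matrix.one_apply, Matrix.one_apply, ← ite_and]
  refine if_congr ⟨fun ⟨h, hf'⟩ => ?_, ?_⟩ rfl rfl
  · rw [← extend_comp_eq hf h, hf', extend_comp_eq hf fun _ _ => rfl]
  · rintro rfl
    exact ⟨fun _ _ => rfl, rfl⟩

variable (K : Type*) [CommSemiring K]

/-- `sites` as a homomorphism of algebras. -/
def sitesAlgHom [Semiring 𝒜] [Algebra K 𝒜] {f : Fin m → Fin n} (hf : Function.Injective f) :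
    Matrix (Fin m → Fin N) (Fin m → Fin N) 𝒜 →ₐ[K] Matrix (Fin n → Fin N) (Fin n → Fin N) 𝒜 :=
  AlgHom.ofLinearMap
    { toFun := sites f
      map_add' := fun X Y => by
        ext a b
        simp only [Matrix.add_apply, sites_apply, ite_add_ite, add_zero]
      map_smul' := fun c X => by
        ext a b
        simp only [Matrix.smul_apply, sites_apply, smul_ite, smul_zero, RingHom.id_apply] }
    (sites_one hf) (sites_mul hf)

@[simp]
theorem sitesAlgHom_apply [Semiring 𝒜] [Algebra K 𝒜] {f : Fin m → Fin n}
    (hf : Function.Injective f) (X : Matrix (Fin m → Fin N) (Fin m → Fin N) 𝒜) :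
    sitesAlgHom K hf X = sites f X := rfl

theorem sites_mul_sites_apply [NonUnitalNonAssocSemiring 𝒜] {m' : ℕ} {f : Fin m → Fin n}
    {g : Fin m' → Fin n} (hg : Function.Injective g)
    (hfg : ∀ i j, f i ≠ g j) (X : Matrix (Fin m → Fin N) (Fin m → Fin N) 𝒜)
    (Y : Matrix (Fin m' → Fin N) (Fin m' → Fin N) 𝒜) (a b : Fin n → Fin N) :
    (sites f X * sites g Y) a b =
      if ∀ l, (∀ k, f k ≠ l) → (∀ k, g k ≠ l) → a l = b l
        then X (a ∘ f) (b ∘ f) * Y (a ∘ g) (b ∘ g) else 0 := by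
  rw [mul_sites_apply hg, Finset.sum_eq_single (a ∘ g)]
  · have hb : Function.extend g (a ∘ g) b ∘ f = b ∘ f := by
      ext k
      exact congrArg _ (extend_apply_of_forall_ne (fun j => (hfg k j).symm) _ _)
    rw [sites_apply, hb, ite_mul, zero_mul]
    refine if_congr (forall₂_congr fun l _ => ?_) rfl rfl
    by_cases hl : ∃ k, g k = l
    · obtain ⟨k, rfl⟩ := hl
      simp [hg.extend_apply]
    · rw [Function.extend_apply' _ _ _ hl]
      simp [not_exists.mp hl]
  · intro p _ hp
    rw [sites_apply, if_neg, zero_mul]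
    refine fun h => hp (funext fun k => ?_)
    rw [Function.comp_apply, h (g k) fun j => hfg j k, hg.extend_apply]
  · simp

theorem commute_sites [NonUnitalNonAssocSemiring 𝒜] {m' : ℕ} {f : Fin m → Fin n}
    {g : Fin m' → Fin n} (hf : Function.Injective f) (hg : Function.Injective g)
    (hfg : ∀ i j, f i ≠ g j) (X : Matrix (Fin m → Fin N) (Fin m → Fin N) 𝒜)
    (Y : Matrix (Fin m' → Fin N) (Fin m' → Fin N) 𝒜)
    (hXY : ∀ a b c d, Commute (X a b) (Y c d)) : Commute (sites f X) (sites g Y) := by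
  ext a b
  rw [sites_mul_sites_apply hg hfg, sites_mul_sites_apply hf fun i j => (hfg j i).symm]
  exact if_congr (forall_congr' fun _ => imp.swap) (hXY _ _ _ _).eq rfl

theorem oneSite_eq_sites [Zero 𝒜] (i : Fin n) (X : Matrix (Fin N) (Fin N) 𝒜) :
    oneSite i X = sites ![i] (X.submatrix (· 0) (· 0)) := by
  ext a b
  simp only [oneSite, sites_apply, Matrix.of_apply, Matrix.submatrix_apply, Fin.forall_fin_one,
    Function.comp, Matrix.cons_val_zero, ne_comm]

theorem twoSite_eq_sites [Zero 𝒜] (i j : Fin n) (X : Matrix (Fin N × Fin N) (Fin N × Fin N) 𝒜) :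
    twoSite i j X = sites ![i, j] (X.submatrix (fun a => (a 0, a 1)) fun a => (a 0, a 1)) := by
  ext a b
  simp only [twoSite, sites_apply, Matrix.of_apply, Matrix.submatrix_apply, Fin.forall_fin_two,
    Function.comp, Matrix.cons_val_zero, Matrix.cons_val_one, ne_comm, and_imp]

theorem sites_sites [Zero 𝒜] {l : ℕ} {g : Fin m → Fin n} (hg : Function.Injective g)
    (f : Fin l → Fin m) (X : Matrix (Fin l → Fin N) (Fin l → Fin N) 𝒜) :
    sites g (sites f X) = sites (g ∘ f) X := by
  ext a b
  rw [sites_apply, sites_apply, sites_apply, ← ite_and]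
  refine if_congr ⟨fun ⟨h, h'⟩ x hx => ?_, fun h =>
    ⟨fun x hx => h x fun k => hx (f k), fun y hy => h (g y) fun k => hg.ne (hy k)⟩⟩ rfl rfl
  by_cases hx' : ∃ y, g y = x
  · obtain ⟨y, rfl⟩ := hx'
    exact h' y fun k hk => hx k (congrArg g hk)
  · exact h x (not_exists.mp hx')

theorem sites_oneSite [Zero 𝒜] {f : Fin m → Fin n} (hf : Function.Injective f) (i : Fin m)
    (X : Matrix (Fin N) (Fin N) 𝒜) : sites f (oneSite i X) = oneSite (f i) X := by
  rw [oneSite_eq_sites, sites_sites hf, oneSite_eq_sites]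
  exact congrArg (sites · _) (FinVec.map_eq f _).symm

theorem sites_twoSite [Zero 𝒜] {f : Fin m → Fin n} (hf : Function.Injective f) (i j : Fin m)
    (X : Matrix (Fin N × Fin N) (Fin N × Fin N) 𝒜) :
    sites f (twoSite i j X) = twoSite (f i) (f j) X := by
  rw [twoSite_eq_sites, sites_sites hf, twoSite_eq_sites]
  exact congrArg (sites · _) (FinVec.map_eq f _).symm

theorem oneSite_mul [NonUnitalNonAssocSemiring 𝒜] (i : Fin n) (X Y : Matrix (Fin N) (Fin N) 𝒜) :
    oneSite i (X * Y) = oneSite i X * oneSite i Y := by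
  rw [oneSite_eq_sites, oneSite_eq_sites, oneSite_eq_sites,
    ← sites_mul (Function.injective_of_subsingleton _)]
  exact congrArg _ (Matrix.submatrix_mul_equiv X Y _ (Equiv.funUnique (Fin 1) (Fin N)) _).symm

theorem oneSite_one [Zero 𝒜] [One 𝒜] (i : Fin n) :
    oneSite i (1 : Matrix (Fin N) (Fin N) 𝒜) = 1 := by
  rw [oneSite_eq_sites, ← sites_one (Function.injective_of_subsingleton ![i])]
  exact congrArg _ (Matrix.submatrix_one_equiv (Equiv.funUnique (Fin 1) (Fin N)))

/-- `twoSite` as a homomorphism of algebras. -/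
def twoSiteAlgHom [Semiring 𝒜] [Algebra K 𝒜] {i j : Fin n} (h : i ≠ j) :
    Matrix (Fin N × Fin N) (Fin N × Fin N) 𝒜 →ₐ[K] Matrix (Fin n → Fin N) (Fin n → Fin N) 𝒜 :=
  (sitesAlgHom K (injective_pair_iff_ne.mpr h)).comp
    (Matrix.reindexAlgEquiv K 𝒜 (finTwoArrowEquiv (Fin N)).symm).toAlgHom

@[simp]
theorem twoSiteAlgHom_apply [Semiring 𝒜] [Algebra K 𝒜] {i j : Fin n} (h : i ≠ j)
    (X : Matrix (Fin N × Fin N) (Fin N × Fin N) 𝒜) : twoSiteAlgHom K h X = twoSite i j X :=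
  (twoSite_eq_sites i j X).symm

theorem oneSite_map {ℬ : Type*} [Zero 𝒜] [Zero ℬ] (i : Fin n) (X : Matrix (Fin N) (Fin N) 𝒜)
    (φ : 𝒜 → ℬ) (hφ : φ 0 = 0) : (oneSite i X).map φ = oneSite i (X.map φ) := by
  ext a b
  simp only [oneSite, Matrix.map_apply, Matrix.of_apply, apply_ite φ, hφ]

theorem twoSite_map {ℬ : Type*} [Zero 𝒜] [Zero ℬ] (i j : Fin n)
    (X : Matrix (Fin N × Fin N) (Fin N × Fin N) 𝒜)
    (φ : 𝒜 → ℬ) (hφ : φ 0 = 0) : (twoSite i j X).map φ = twoSite i j (X.map φ) := by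
  ext a b
  simp only [twoSite, Matrix.map_apply, Matrix.of_apply, apply_ite φ, hφ]

end Sites

section Generator

variable {N n : ℕ} {R S : Matrix (Fin N × Fin N) (Fin N × Fin N) ℂ} {q : ℂ}

theorem IsHeckeSymmetry.mul_inv (h : IsHeckeSymmetry q R) : R * R⁻¹ = 1 := by
  have hR : R * (R - (q - q⁻¹) • 1) = 1 := by
    rw [mul_sub, h.hecke, mul_smul_comm, mul_one, add_sub_cancel_right]
  rwa [Matrix.inv_eq_right_inv hR]

theorem IsHeckeSymmetry.inv_mul (h : IsHeckeSymmetry q R) : R⁻¹ * R = 1 :=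
  mul_eq_one_comm.mp h.mul_inv

/-- The operator `R_{i+1}` on `V^{⊗n}`, that is, `R` in the factors `i` and `i + 1` counted from
`0`. It is `1` if there are no such factors. -/
def generator (n : ℕ) (R : Matrix (Fin N × Fin N) (Fin N × Fin N) ℂ) (i : ℕ) :
    Matrix (Fin n → Fin N) (Fin n → Fin N) ℂ :=
  if h : i + 1 < n then twoSite ⟨i, by omega⟩ ⟨i + 1, h⟩ R else 1

theorem generator_of_lt {i : ℕ} (h : i + 1 < n) :
    generator n R i = twoSite ⟨i, by omega⟩ ⟨i + 1, h⟩ R :=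
  dif_pos h

theorem mk_ne_mk_succ {i : ℕ} (h : i + 1 < n) :
    (⟨i, Nat.lt_of_succ_lt h⟩ : Fin n) ≠ ⟨i + 1, h⟩ := by
  simp

theorem generator_mul_generator (h : R * S = 1) (i : ℕ) :
    generator n R i * generator n S i = 1 := by
  unfold generator
  split_ifs with hi
  · simpa only [map_mul, map_one, twoSiteAlgHom_apply] using
      congrArg (twoSiteAlgHom ℂ (mk_ne_mk_succ hi)) h
  · exact mul_one 1

theorem commute_generator {i j : ℕ} (hij : i + 1 < j) (hj : j + 1 < n) :
    Commute (generator n R i) (generator n S j) := by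
  rw [generator_of_lt (by omega), generator_of_lt hj, twoSite_eq_sites, twoSite_eq_sites]
  refine commute_sites (injective_pair_iff_ne.mpr (mk_ne_mk_succ _))
    (injective_pair_iff_ne.mpr (mk_ne_mk_succ _)) ?_ _ _ fun _ _ _ _ => Commute.all _ _
  simp only [Fin.forall_fin_two, Matrix.cons_val_zero, Matrix.cons_val_one, ne_eq, Fin.mk.injEq]
  omega

theorem IsHeckeSymmetry.isHeckeRep (h : IsHeckeSymmetry q R) (n : ℕ) :
    IsHeckeRep n q (generator n R) where
  braid i hi := by
    let f : Fin 3 → Fin n := fun k => ⟨i + k, by omega⟩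
    have hf : Function.Injective f := fun a b hab => by
      simpa only [f, Fin.mk.injEq, Nat.add_left_cancel_iff, Fin.val_inj] using hab
    have hbraid := congrArg (sites f) h.braid
    simp only [sites_mul hf, sites_twoSite hf] at hbraid
    rw [generator_of_lt (by omega), generator_of_lt hi]
    exact hbraid
  comm _ _ hij hj := commute_generator hij hj
  hecke i hi := by
    simpa only [map_mul, map_add, map_one, map_smul, twoSiteAlgHom_apply, generator_of_lt hi] using
      congrArg (twoSiteAlgHom ℂ (mk_ne_mk_succ hi)) h.hecke

theorem skewSymm_eq_skewElem (hq : q ≠ 0) (hq2 : q ^ 2 ≠ 1) (k : ℕ) (hk : k ≤ n) :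
    skewSymm q R n k hk = skewElem q (generator n R) k := by
  induction k using Nat.twoStepInduction with
  | zero | one => rfl
  | more k _ ih =>
    rw [skewSymm, skewElem_add_two, ih, generator_of_lt (by omega), qInt_eq_qNum hq hq2]

theorem sites_castLE_generator {m i : ℕ} (h : n ≤ m) (hi : i + 1 < n) :
    sites (Fin.castLE h) (generator n R i) = generator m R i := by
  rw [generator_of_lt hi, generator_of_lt (by omega), sites_twoSite (Fin.castLE_injective h)]
  rfl

theorem sites_castLE_skewElem {m k : ℕ} (h : n ≤ m) (hk : k ≤ n) :
    sites (Fin.castLE h) (skewElem q (generator n R) k) = skewElem q (generator m R) k := by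
  rw [← sitesAlgHom_apply ℂ (Fin.castLE_injective h), map_skewElem]
  exact skewElem_congr fun i hi => sites_castLE_generator h (hi.trans_le hk)

end Generator

section ScalarMat

variable {N n : ℕ} {𝒜 ι : Type*} [Ring 𝒜] [Algebra ℂ 𝒜]

theorem scalarMat_mul [Fintype ι] (X Y : Matrix ι ι ℂ) :
    scalarMat 𝒜 (X * Y) = scalarMat 𝒜 X * scalarMat 𝒜 Y :=
  Matrix.map_mul

theorem scalarMat_one [DecidableEq ι] : scalarMat 𝒜 (1 : Matrix ι ι ℂ) = 1 :=
  Matrix.map_one _ (map_zero _) (map_one _)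

theorem twoSite_scalarMat (i j : Fin n) (X : Matrix (Fin N × Fin N) (Fin N × Fin N) ℂ) :
    twoSite i j (scalarMat 𝒜 X) = scalarMat 𝒜 (twoSite i j X) :=
  (twoSite_map i j X _ (map_zero _)).symm

end ScalarMat

section GeneratorUnit

variable {N n : ℕ} (𝒜 : Type*) [Ring 𝒜] [Algebra ℂ 𝒜]
  {R : Matrix (Fin N × Fin N) (Fin N × Fin N) ℂ} {q : ℂ}

/-- The operators `R_1`, `R_2`, … as units of the algebra of matrices over `𝒜`. -/
noncomputable def generatorUnit (n : ℕ) (h : IsHeckeSymmetry q R) (i : ℕ) :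
    (Matrix (Fin n → Fin N) (Fin n → Fin N) 𝒜)ˣ where
  val := scalarMat 𝒜 (generator n R i)
  inv := scalarMat 𝒜 (generator n R⁻¹ i)
  val_inv := by rw [← scalarMat_mul, generator_mul_generator h.mul_inv, scalarMat_one]
  inv_val := by rw [← scalarMat_mul, generator_mul_generator h.inv_mul, scalarMat_one]

theorem val_generatorUnit (h : IsHeckeSymmetry q R) (i : ℕ) :
    (generatorUnit 𝒜 n h i).1 = scalarMat 𝒜 (generator n R i) := rfl

theorem val_inv_generatorUnit (h : IsHeckeSymmetry q R) (i : ℕ) :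
    (generatorUnit 𝒜 n h i)⁻¹.1 = scalarMat 𝒜 (generator n R⁻¹ i) := rfl

variable {𝒜}

theorem overlineCopy_eq_copy (h : IsHeckeSymmetry q R) (X : Matrix (Fin N) (Fin N) 𝒜) (k : ℕ)
    (hk : k < n) : overlineCopy R X n k hk =
      copy (generatorUnit 𝒜 n h) (oneSite ⟨0, by omega⟩ X) k := by
  induction k with
  | zero => exact (copy_zero _ _).symm
  | succ k ih =>
    rw [overlineCopy, copy_succ_eq_mul, ih, twoSite_scalarMat, twoSite_scalarMat,
      ← generator_of_lt, ← generator_of_lt, val_generatorUnit, val_inv_generatorUnit]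

theorem isBraidRep_generatorUnit (h : IsHeckeSymmetry q R) (n : ℕ) :
    IsBraidRep n (generatorUnit 𝒜 n h) where
  braid i hi := Units.ext <| by
    simp only [Units.val_mul, val_generatorUnit, ← scalarMat_mul, (h.isHeckeRep n).braid i hi]
  comm i j hij hj := Units.ext <| by
    simp only [Units.val_mul, val_generatorUnit, ← scalarMat_mul,
      ((h.isHeckeRep n).comm i j hij hj).eq]

theorem isFirstFactor_oneSite (h : IsHeckeSymmetry q R) (hn : 0 < n)
    (X : Matrix (Fin N) (Fin N) 𝒜) :
    IsFirstFactor n (generatorUnit 𝒜 n h) (oneSite ⟨0, hn⟩ X) := by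
  intro i hi0 hi
  rw [val_generatorUnit, generator_of_lt hi, ← twoSite_scalarMat, twoSite_eq_sites,
    oneSite_eq_sites]
  refine commute_sites (injective_pair_iff_ne.mpr (mk_ne_mk_succ hi))
    (Function.injective_of_subsingleton _) ?_ _ _
    fun _ _ _ _ => Algebra.commute_algebraMap_left _ _
  simp only [Fin.forall_fin_two, Fin.forall_fin_one, Matrix.cons_val_zero, Matrix.cons_val_one,
    ne_eq, Fin.mk.injEq]
  omega

end GeneratorUnit

section QuantumDouble

variable {N n : ℕ} {R : Matrix (Fin N × Fin N) (Fin N × Fin N) ℂ} {q : ℂ}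

/-- Matrices over the free algebra in `V ⊗ V` as matrices over the quantum double in the first two
factors of `V^{⊗n}`: the homomorphism carrying the defining relations to `V^{⊗n}`. -/
def toFirstTwo (R : Matrix (Fin N × Fin N) (Fin N × Fin N) ℂ) (hn : 2 ≤ n) :
    Matrix (Fin 2 → Fin N) (Fin 2 → Fin N) (FreeAlgebra ℂ (Gen N)) →ₐ[ℂ]
      Matrix (Fin n → Fin N) (Fin n → Fin N) (QuantumDouble R) :=
  (sitesAlgHom ℂ (Fin.castLE_injective hn)).comp (RingQuot.mkAlgHom ℂ (DoubleRel R)).mapMatrix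

variable (hn : 2 ≤ n)

theorem toFirstTwo_eq_of_rel {X Y : Matrix (Fin 2 → Fin N) (Fin 2 → Fin N) (FreeAlgebra ℂ (Gen N))}
    (h : ∀ a b, DoubleRel R (X a b) (Y a b)) : toFirstTwo R hn X = toFirstTwo R hn Y :=
  congrArg (sitesAlgHom ℂ (Fin.castLE_injective hn))
    (Matrix.ext fun a b => RingQuot.mkAlgHom_rel ℂ (h a b))

theorem toFirstTwo_free₁₂ (X : Matrix (Fin N × Fin N) (Fin N × Fin N) ℂ) :
    toFirstTwo R hn (free₁₂ X) = scalarMat (QuantumDouble R) (generator n X 0) := by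
  have hX : (scalarMat (FreeAlgebra ℂ (Gen N)) X).map (RingQuot.mkAlgHom ℂ (DoubleRel R)) =
      scalarMat (QuantumDouble R) X :=
    Matrix.ext fun _ _ => AlgHom.commutes _ _
  rw [toFirstTwo, AlgHom.comp_apply, AlgHom.mapMatrix_apply, twoSite_map _ _ _ _ (map_zero _), hX,
    sitesAlgHom_apply, sites_twoSite (Fin.castLE_injective hn), twoSite_scalarMat,
    generator_of_lt hn]
  rfl

theorem toFirstTwo_oneSite (X : Matrix (Fin N) (Fin N) (FreeAlgebra ℂ (Gen N))) :
    toFirstTwo R hn (oneSite 0 X) =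
      oneSite ⟨0, by omega⟩ (X.map (RingQuot.mkAlgHom ℂ (DoubleRel R))) := by
  rw [toFirstTwo, AlgHom.comp_apply, AlgHom.mapMatrix_apply, oneSite_map _ _ _ (map_zero _),
    sitesAlgHom_apply, sites_oneSite (Fin.castLE_injective hn)]
  rfl

theorem isDouble_quantumDouble (h : IsHeckeSymmetry q R) (hn : 0 < n) :
    IsDouble n (generatorUnit (QuantumDouble R) n h) (oneSite ⟨0, hn⟩ (matM R))
      (oneSite ⟨0, hn⟩ (matD R)) where
  rep := isBraidRep_generatorUnit h n
  first_m := isFirstFactor_oneSite h hn _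
  first_d := isFirstFactor_oneSite h hn _
  refl_m h1 := by
    simpa only [map_mul, toFirstTwo_free₁₂, toFirstTwo_oneSite, val_generatorUnit, matM] using
      toFirstTwo_eq_of_rel h1 DoubleRel.reflM
  refl_d h1 := by
    simpa only [map_mul, toFirstTwo_free₁₂, toFirstTwo_oneSite, val_inv_generatorUnit, matD] using
      toFirstTwo_eq_of_rel h1 DoubleRel.reflD
  perm h1 := by
    simpa only [map_mul, map_add, toFirstTwo_free₁₂, toFirstTwo_oneSite, val_generatorUnit,
      val_inv_generatorUnit, matM, matD] using
      toFirstTwo_eq_of_rel h1 DoubleRel.perm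

end QuantumDouble

section RTrace

open scoped Kronecker

variable {N m n : ℕ} {K : Type*} [CommRing K] (C : Matrix (Fin N) (Fin N) K)

/-- `C ⊗ ⋯ ⊗ C` on `V^{⊗n}`. -/
def tensorPower (n : ℕ) (C : Matrix (Fin N) (Fin N) K) :
    Matrix (Fin n → Fin N) (Fin n → Fin N) K :=
  Matrix.of fun a b => ∏ i, C (a i) (b i)

theorem tensorPower_apply (a b : Fin n → Fin N) :
    tensorPower n C a b = ∏ i, C (a i) (b i) := rfl

/-- The partial trace `Tr_{(n+1)} (C_{n+1} Y)` over the last factor of `V^{⊗(n+1)}`. -/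
def partialTrace (C : Matrix (Fin N) (Fin N) K) :
    Matrix (Fin (n + 1) → Fin N) (Fin (n + 1) → Fin N) K →ₗ[K]
      Matrix (Fin n → Fin N) (Fin n → Fin N) K where
  toFun Y := Matrix.of fun a b => (C * Y.submatrix (Fin.snoc a) (Fin.snoc b)).trace
  map_add' X Y := by
    ext a b
    simp only [Matrix.submatrix_add, Pi.add_apply, mul_add, Matrix.trace_add, Matrix.of_apply,
      Matrix.add_apply]
  map_smul' r Y := by
    ext a b
    simp only [Matrix.submatrix_smul, Pi.smul_apply, mul_smul_comm, Matrix.trace_smul,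
      Matrix.of_apply, Matrix.smul_apply, RingHom.id_apply]

theorem partialTrace_apply (Y : Matrix (Fin (n + 1) → Fin N) (Fin (n + 1) → Fin N) K)
    (a b : Fin n → Fin N) :
    partialTrace C Y a b = (C * Y.submatrix (Fin.snoc a) (Fin.snoc b)).trace := rfl

theorem snoc_comp_castLE (a : Fin n → Fin N) (d : Fin N) :
    (Fin.snoc a d : Fin (n + 1) → Fin N) ∘ Fin.castLE n.le_succ = a :=
  funext fun i => Fin.snoc_castSucc (α := fun _ => Fin N) d a i

theorem extend_castLE_snoc (p a : Fin n → Fin N) (d : Fin N) :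
    Function.extend (Fin.castLE n.le_succ) p (Fin.snoc a d : Fin (n + 1) → Fin N) =
      Fin.snoc p d := by
  ext i
  congr 1
  refine Fin.lastCases ?_ (fun i => ?_) i
  · have hlast (k : Fin n) : Fin.castLE n.le_succ k ≠ Fin.last n := (Fin.castSucc_lt_last k).ne
    rw [extend_apply_of_forall_ne hlast, Fin.snoc_last, Fin.snoc_last]
  · rw [Fin.snoc_castSucc]
    exact (Fin.castLE_injective n.le_succ).extend_apply p _ i

section

variable (X : Matrix (Fin n → Fin N) (Fin n → Fin N) K)
  (Y : Matrix (Fin (n + 1) → Fin N) (Fin (n + 1) → Fin N) K)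

theorem partialTrace_sites_mul :
    partialTrace C (sites (Fin.castLE n.le_succ) X * Y) = X * partialTrace C Y := by
  ext a b
  have hsub : (sites (Fin.castLE n.le_succ) X * Y).submatrix (Fin.snoc a) (Fin.snoc b) =
      ∑ p, X a p • Y.submatrix (Fin.snoc p) (Fin.snoc b) := by
    ext d c
    simp only [Matrix.submatrix_apply, sites_mul_apply (Fin.castLE_injective n.le_succ),
      snoc_comp_castLE, extend_castLE_snoc, Matrix.sum_apply, Matrix.smul_apply, smul_eq_mul]
  simp only [partialTrace_apply, hsub, Finset.mul_sum, mul_smul_comm, Matrix.trace_sum,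
    Matrix.trace_smul, Matrix.mul_apply, smul_eq_mul]

theorem partialTrace_mul_sites :
    partialTrace C (Y * sites (Fin.castLE n.le_succ) X) = partialTrace C Y * X := by
  ext a b
  have hsub : (Y * sites (Fin.castLE n.le_succ) X).submatrix (Fin.snoc a) (Fin.snoc b) =
      ∑ p, X p b • Y.submatrix (Fin.snoc a) (Fin.snoc p) := by
    ext d c
    simp only [Matrix.submatrix_apply, mul_sites_apply (Fin.castLE_injective n.le_succ),
      snoc_comp_castLE, extend_castLE_snoc, Matrix.sum_apply, Matrix.smul_apply, smul_eq_mul,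
      mul_comm]
  simp only [partialTrace_apply, hsub, Finset.mul_sum, mul_smul_comm, Matrix.trace_sum,
    Matrix.trace_smul, Matrix.mul_apply, smul_eq_mul, mul_comm]

theorem trace_tensorPower_succ_mul :
    (tensorPower (n + 1) C * Y).trace = (tensorPower n C * partialTrace C Y).trace := by
  simp only [Matrix.trace, Matrix.diag_apply, Matrix.mul_apply, partialTrace_apply,
    tensorPower_apply, ← (Fin.snocEquiv fun _ => Fin N).sum_comp, Fintype.sum_prod_type,
    Fin.snocEquiv, Equiv.coe_fn_mk, Fin.prod_univ_castSucc, Fin.snoc_castSucc, Fin.snoc_last,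
    Finset.mul_sum, Matrix.submatrix_apply, mul_assoc]
  rw [Finset.sum_comm]
  refine Finset.sum_congr rfl fun a _ => ?_
  rw [Finset.sum_congr rfl fun d _ => Finset.sum_comm, Finset.sum_comm]

end

theorem partialTrace_one : partialTrace C (1 : Matrix (Fin (n + 1) → Fin N) _ K) =
    C.trace • 1 := by
  ext a b
  have hsub : Matrix.submatrix (1 : Matrix (Fin (n + 1) → Fin N) (Fin (n + 1) → Fin N) K)
      (Fin.snoc a) (Fin.snoc b) = (1 : Matrix _ _ K) a b • (1 : Matrix (Fin N) (Fin N) K) := by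
    ext d c
    simp only [Matrix.submatrix_apply, Matrix.smul_apply, Matrix.one_apply, Fin.snoc_inj,
      smul_eq_mul, ite_and, ite_mul, one_mul, zero_mul]
  rw [partialTrace_apply, hsub, mul_smul_comm, mul_one, Matrix.trace_smul, Matrix.smul_apply,
    smul_eq_mul, smul_eq_mul, mul_comm]

/-- The block `(i, j)` of an operator `R` on `V ⊗ V`, an operator on the second factor. -/
def block (R : Matrix (Fin N × Fin N) (Fin N × Fin N) K) (i j : Fin N) :
    Matrix (Fin N) (Fin N) K :=
  R.submatrix (Prod.mk i) (Prod.mk j)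

theorem block_mul (R S : Matrix (Fin N × Fin N) (Fin N × Fin N) K) (i j : Fin N) :
    block (R * S) i j = ∑ k, block R i k * block S k j := by
  ext a b
  simp only [block, Matrix.submatrix_apply, Matrix.mul_apply, Fintype.sum_prod_type,
    Matrix.sum_apply]

theorem block_kronecker (A B : Matrix (Fin N) (Fin N) K) (i j : Fin N) :
    block (A ⊗ₖ B) i j = A i j • B := rfl

/-- The operator `Tr₂ (C₂ R)` on `V`, for `R` acting in `V ⊗ V`. -/
def traceSecond (C : Matrix (Fin N) (Fin N) K) (R : Matrix (Fin N × Fin N) (Fin N × Fin N) K) :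
    Matrix (Fin N) (Fin N) K :=
  Matrix.of fun i j => (C * block R i j).trace

theorem traceSecond_apply (R : Matrix (Fin N × Fin N) (Fin N × Fin N) K) (i j : Fin N) :
    traceSecond C R i j = (C * block R i j).trace := rfl

theorem traceSecond_apply_eq_sum (R : Matrix (Fin N × Fin N) (Fin N × Fin N) K) (i j : Fin N) :
    traceSecond C R i j = ∑ b, ∑ a, C b a * R (i, a) (j, b) := by
  simp only [traceSecond_apply, Matrix.trace, Matrix.diag_apply, Matrix.mul_apply, block,
    Matrix.submatrix_apply]

theorem partialTrace_twoSite (R : Matrix (Fin N × Fin N) (Fin N × Fin N) K) (i : Fin n) :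
    partialTrace C (twoSite i.castSucc (Fin.last n) R) = oneSite i (traceSecond C R) := by
  ext a b
  have hagree (d c : Fin N) : (∀ l, l ≠ i.castSucc → l ≠ Fin.last n →
      (Fin.snoc a d : Fin (n + 1) → Fin N) l = (Fin.snoc b c : Fin (n + 1) → Fin N) l) ↔
      ∀ l, l ≠ i → a l = b l := by
    simp only [Fin.forall_fin_succ', Fin.snoc_castSucc, ne_eq, Fin.castSucc_inj,
      (Fin.castSucc_lt_last _).ne, not_true_eq_false, not_false_eq_true, true_imp_iff,
      false_imp_iff, imp_true_iff, and_true]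
  have hsub : (twoSite i.castSucc (Fin.last n) R).submatrix (Fin.snoc a) (Fin.snoc b) =
      if ∀ l, l ≠ i → a l = b l then block R (a i) (b i) else 0 := by
    ext d c
    simp only [twoSite, Matrix.submatrix_apply, Matrix.of_apply, hagree, Fin.snoc_castSucc,
      Fin.snoc_last]
    split_ifs <;> rfl
  rw [partialTrace_apply, hsub]
  simp only [oneSite, Matrix.of_apply, traceSecond]
  split_ifs
  · rfl
  · rw [mul_zero, Matrix.trace_zero]

theorem tensorPower_extend {f : Fin m → Fin n} (hf : Function.Injective f)
    (a b : Fin n → Fin N) (p : Fin m → Fin N) :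
    tensorPower n C a (Function.extend f p b) = tensorPower m C (a ∘ f) p *
      ∏ l ∈ (Finset.univ.image f)ᶜ, C (a l) (b l) := by
  rw [tensorPower_apply, ← Finset.prod_mul_prod_compl (Finset.univ.image f),
    Finset.prod_image hf.injOn, tensorPower_apply]
  congr 1
  · exact Finset.prod_congr rfl fun k _ => by rw [hf.extend_apply, Function.comp_apply]
  · exact Finset.prod_congr rfl fun l hl => by
      rw [extend_apply_of_forall_ne (by simpa using hl)]

theorem commute_tensorPower_sites {f : Fin m → Fin n} (hf : Function.Injective f)
    {X : Matrix (Fin m → Fin N) (Fin m → Fin N) K} (h : Commute (tensorPower m C) X) :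
    Commute (tensorPower n C) (sites f X) := by
  ext a b
  have hX := congrFun₂ h.eq (a ∘ f) (b ∘ f)
  have hextend (p : Fin m → Fin N) : tensorPower n C (Function.extend f p a) b =
      tensorPower m C p (b ∘ f) * ∏ l ∈ (Finset.univ.image f)ᶜ, C (a l) (b l) :=
    tensorPower_extend C.transpose hf b a p
  rw [Matrix.mul_apply, Matrix.mul_apply] at hX
  simp only [mul_sites_apply hf, sites_mul_apply hf, tensorPower_extend C hf, hextend,
    ← mul_assoc, ← Finset.sum_mul, ← hX]
  simp only [Finset.sum_mul, mul_right_comm]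

theorem commute_tensorPower_twoSite {R : Matrix (Fin N × Fin N) (Fin N × Fin N) K}
    (h : Commute (C ⊗ₖ C) R) {i j : Fin n} (hij : i ≠ j) :
    Commute (tensorPower n C) (twoSite i j R) := by
  have hC : tensorPower 2 C =
      Matrix.reindexAlgEquiv K K (finTwoArrowEquiv (Fin N)).symm (C ⊗ₖ C) :=
    Matrix.ext fun a b => Fin.prod_univ_two fun i => C (a i) (b i)
  rw [twoSite_eq_sites]
  refine commute_tensorPower_sites C (injective_pair_iff_ne.mpr hij) ?_
  rw [hC]
  exact h.map (Matrix.reindexAlgEquiv K K (finTwoArrowEquiv (Fin N)).symm)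

end RTrace

section SkewInverse

open scoped Kronecker

variable {N : ℕ} {q : ℂ} {C : Matrix (Fin N) (Fin N) ℂ}
  {R Ψ X Y Z : Matrix (Fin N × Fin N) (Fin N × Fin N) ℂ}

theorem traceSecond_traceSecond (h : ∀ i₁ i₃ j₁ j₃,
    ∑ a, ∑ b, X (i₁, a) (j₁, b) * Y (b, i₃) (a, j₃) = flip N (i₁, i₃) (j₁, j₃))
    (A : Matrix (Fin N) (Fin N) ℂ) : traceSecond (traceSecond A Y) X = A := by
  ext i j
  calc traceSecond (traceSecond A Y) X i j
    _ = ∑ b, ∑ a, (∑ p : Fin N × Fin N, A p.1 p.2 * Y (b, p.2) (a, p.1)) * X (i, a) (j, b) := by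
      simp only [traceSecond_apply_eq_sum, Fintype.sum_prod_type]
    _ = ∑ p : Fin N × Fin N, A p.1 p.2 * ∑ a, ∑ b, X (i, a) (j, b) * Y (b, p.2) (a, p.1) := by
      simp only [Finset.mul_sum, Finset.sum_mul]
      rw [Finset.sum_comm_cycle]
      refine Finset.sum_congr rfl fun p _ => ?_
      rw [Finset.sum_comm]
      simp only [mul_comm, mul_left_comm]
    _ = ∑ p : Fin N × Fin N, A p.1 p.2 * flip N (i, p.2) (j, p.1) := by simp only [h]
    _ = A i j := by simp [flip, Fintype.sum_prod_type, ite_and]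

theorem traceMatrix_eq_traceSecond (Ψ : Matrix (Fin N × Fin N) (Fin N × Fin N) ℂ) :
    traceMatrix Ψ = traceSecond 1 Ψ := by
  ext i j
  rw [traceSecond_apply, one_mul]
  rfl

theorem IsSkewInverse.traceSecond_traceMatrix (hΨ : IsSkewInverse R Ψ) :
    traceSecond (traceMatrix Ψ) R = 1 := by
  rw [traceMatrix_eq_traceSecond, traceSecond_traceSecond hΨ.1]

theorem IsSkewInverse.traceSecond_injective (hΨ : IsSkewInverse R Ψ) :
    Function.Injective (traceSecond · R) :=
  Function.LeftInverse.injective (g := (traceSecond · Ψ)) (traceSecond_traceSecond hΨ.2)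

theorem partialTrace_generator (hC : traceSecond C R = 1) (n : ℕ) :
    partialTrace C (generator (n + 2) R n) = 1 := by
  rw [generator_of_lt n.succ.lt_succ_self]
  exact (partialTrace_twoSite C R (Fin.last n)).trans (by rw [hC, oneSite_one])

theorem inv_mul_mul_eq_of_braid {G : Type*} [Group G] {a b : G} (h : a * b * a = b * a * b) :
    b⁻¹ * (a * b) = a * (b * a⁻¹) := by
  rw [inv_mul_eq_iff_eq_mul, ← mul_assoc, ← mul_assoc, eq_mul_inv_iff_mul_eq, h, mul_assoc]

section Braid

variable (hR : IsHeckeSymmetry q R)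
include hR

theorem IsHeckeSymmetry.conj_generator :
    generator 3 R⁻¹ 1 * (generator 3 R 0 * generator 3 R 1) =
        generator 3 R 0 * (generator 3 R 1 * generator 3 R⁻¹ 0) ∧
      generator 3 R 1 * (generator 3 R 0 * generator 3 R⁻¹ 1) =
        generator 3 R⁻¹ 0 * (generator 3 R 1 * generator 3 R 0) := by
  let g (i : ℕ) : (Matrix (Fin 3 → Fin N) (Fin 3 → Fin N) ℂ)ˣ :=
    ⟨generator 3 R i, generator 3 R⁻¹ i, generator_mul_generator hR.mul_inv i,
      generator_mul_generator hR.inv_mul i⟩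
  have hbraid : g 0 * g 1 * g 0 = g 1 * g 0 * g 1 :=
    Units.ext ((hR.isHeckeRep 3).braid 0 (by omega))
  exact ⟨congrArg Units.val (inv_mul_mul_eq_of_braid hbraid),
    congrArg Units.val (inv_mul_mul_eq_of_braid hbraid.symm).symm⟩

theorem partialTrace_inv_mul_mul (hC : traceSecond C R = 1) : partialTrace C
    (generator 3 R⁻¹ 1 * (generator 3 R 0 * generator 3 R 1)) = 1 := by
  rw [hR.conj_generator.1, ← sites_castLE_generator (Nat.le_succ 2) Nat.one_lt_two,
    ← sites_castLE_generator (Nat.le_succ 2) Nat.one_lt_two, partialTrace_sites_mul,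
    partialTrace_mul_sites, partialTrace_generator hC, one_mul,
    generator_mul_generator hR.mul_inv]

theorem partialTrace_mul_mul_inv (hC : traceSecond C R = 1) : partialTrace C
    (generator 3 R 1 * (generator 3 R 0 * generator 3 R⁻¹ 1)) = 1 := by
  rw [hR.conj_generator.2, ← sites_castLE_generator (Nat.le_succ 2) Nat.one_lt_two,
    ← sites_castLE_generator (Nat.le_succ 2) Nat.one_lt_two, partialTrace_sites_mul,
    partialTrace_mul_sites, partialTrace_generator hC, one_mul,
    generator_mul_generator hR.inv_mul]

end Braid

theorem submatrix_generator_mul_mul (i j i' j' : Fin N) :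
    (generator 3 X 1 * (generator 3 Y 0 * generator 3 Z 1)).submatrix
      (Fin.snoc ![i', i]) (Fin.snoc ![j', j]) =
      ∑ x, ∑ y, Y (i', x) (j', y) • (block X i x * block Z y j) := by
  have hf := injective_pair_iff_ne.mpr (show (1 : Fin 3) ≠ 2 by decide)
  have hsnoc (i j k : Fin N) : (Fin.snoc ![i, j] k : Fin 3 → Fin N) = ![i, j, k] := by
    ext l
    fin_cases l <;> rfl
  have hextend (i j k : Fin N) (p : Fin 2 → Fin N) :
      Function.extend ![1, 2] p ![i, j, k] = ![i, p 0, p 1] := by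
    ext l
    fin_cases l
    · exact congrArg _ (extend_apply_of_forall_ne (by decide) _ _)
    · exact congrArg _ (hf.extend_apply p _ 0)
    · exact congrArg _ (hf.extend_apply p _ 1)
  have htwoSite (i x e j y f : Fin N) : twoSite 0 1 Y ![i, x, e] ![j, y, f] =
      if e = f then Y (i, x) (j, y) else 0 := by
    exact if_congr (by simp [Fin.forall_fin_succ]) rfl rfl
  ext c d
  rw [generator_of_lt (by omega), generator_of_lt (by omega), generator_of_lt (by omega)]
  simp only [Fin.reduceFinMk, Nat.reduceAdd, twoSite_eq_sites 1 2, Matrix.submatrix_apply, hsnoc,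
    sites_mul_apply hf, mul_sites_apply hf, hextend, htwoSite, Finset.mul_sum,
    ← (finTwoArrowEquiv (Fin N)).symm.sum_comp, Fintype.sum_prod_type, finTwoArrowEquiv_symm_apply,
    Matrix.cons_val_zero, Matrix.cons_val_one, Function.comp_apply, ite_mul, zero_mul,
    Finset.sum_ite_eq, Finset.mem_univ, if_true, Matrix.sum_apply, Matrix.smul_apply,
    Matrix.mul_apply, block, smul_eq_mul]
  refine Finset.sum_congr rfl fun x _ => Finset.sum_comm.trans ?_
  exact Finset.sum_congr rfl fun y _ => Finset.sum_congr rfl fun e _ => mul_left_comm _ _ _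

theorem trace_block_mul_block (hinj : Function.Injective (traceSecond · R))
    (hC : traceSecond C R = 1)
    (h : partialTrace C (generator 3 X 1 * (generator 3 R 0 * generator 3 Z 1)) = 1)
    (i j x y : Fin N) :
    (C * (block X i x * block Z y j)).trace = (1 : Matrix _ _ ℂ) i j * C y x := by
  suffices Matrix.of (fun y x => (C * (block X i x * block Z y j)).trace) =
    (1 : Matrix _ _ ℂ) i j • C from congrFun₂ this y x
  apply hinj
  ext i' j'
  have h' := congrFun₂ h ![i', i] ![j', j]
  rw [partialTrace_apply, submatrix_generator_mul_mul] at h'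
  calc traceSecond (Matrix.of fun y x => (C * (block X i x * block Z y j)).trace) R i' j'
    _ = (1 : Matrix (Fin 2 → Fin N) _ ℂ) ![i', i] ![j', j] := by
      rw [← h', traceSecond_apply_eq_sum, Finset.sum_comm]
      simp only [Matrix.of_apply, Finset.mul_sum, mul_smul_comm, Matrix.trace_sum,
        Matrix.trace_smul, smul_eq_mul, mul_comm]
    _ = (1 : Matrix _ _ ℂ) i j * traceSecond C R i' j' := by
      simp [hC, Matrix.one_apply, ← ite_and, and_comm]
    _ = traceSecond ((1 : Matrix _ _ ℂ) i j • C) R i' j' := by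
      rw [traceSecond_apply, traceSecond_apply, smul_mul_assoc, Matrix.trace_smul,
        smul_eq_mul]

theorem commute_kronecker (hR : IsHeckeSymmetry q R) (hinj : Function.Injective (traceSecond · R))
    (hC : traceSecond C R = 1) :
    Commute (C ⊗ₖ C) R := by
  have hright (i j x y : Fin N) : (C * (block R⁻¹ i x * block R y j)).trace =
      (1 : Matrix _ _ ℂ) i j * C y x :=
    trace_block_mul_block hinj hC (partialTrace_inv_mul_mul hR hC) i j x y
  have hleft (i j x y : Fin N) : (C * (block R i x * block R⁻¹ y j)).trace =
      (1 : Matrix _ _ ℂ) i j * C y x :=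
    trace_block_mul_block hinj hC (partialTrace_mul_mul_inv hR hC) i j x y
  have hinv : Commute (C ⊗ₖ C) R⁻¹ := by
    suffices ∀ i k, block ((C ⊗ₖ C) * R⁻¹) i k = block (R⁻¹ * (C ⊗ₖ C)) i k from
      Matrix.ext fun a b => congrFun₂ (this a.1 b.1) a.2 b.2
    intro i k
    apply hinj
    ext p r
    calc (block ((C ⊗ₖ C) * R⁻¹) i k * block R p r).trace
      _ = ∑ x, C i x * (C * (block R⁻¹ x k * block R p r)).trace := by
        simp only [block_mul, block_kronecker, Finset.sum_mul, smul_mul_assoc, mul_assoc,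
          Matrix.trace_sum, Matrix.trace_smul, smul_eq_mul]
      _ = C i r * C p k := by
        simp only [hright, Matrix.one_apply, ite_mul, one_mul, zero_mul, mul_ite, mul_zero,
          Finset.sum_ite_eq', Finset.mem_univ, if_true]
      _ = ∑ x, C x k * (C * (block R p r * block R⁻¹ i x)).trace := by
        simp only [hleft, Matrix.one_apply, ite_mul, one_mul, zero_mul, mul_ite, mul_zero,
          Finset.sum_ite_eq, Finset.mem_univ, if_true, mul_comm (C p k)]
      _ = (block (R⁻¹ * (C ⊗ₖ C)) i k * block R p r).trace := by
        simp only [block_mul, block_kronecker, Finset.sum_mul, mul_smul_comm, smul_mul_assoc,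
          mul_assoc, Matrix.trace_sum, Matrix.trace_smul, smul_eq_mul,
          Matrix.trace_mul_comm (block R⁻¹ i _)]
  let u : (Matrix (Fin N × Fin N) (Fin N × Fin N) ℂ)ˣ := ⟨R, R⁻¹, hR.mul_inv, hR.inv_mul⟩
  exact (Commute.units_inv_right_iff (u := u)).mp hinv

end SkewInverse

section Idempotent

open scoped Matrix

variable {ι K : Type*} [Fintype ι] [Field K]

theorem trace_eq_rank_of_isIdempotentElem {A : Matrix ι ι K} (h : IsIdempotentElem A) :
    A.trace = A.rank := by
  classical
  rw [← Matrix.trace_toLin'_eq]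
  exact (LinearMap.IsIdempotentElem.isProj_range _ (h.map Matrix.toLinAlgEquiv')).trace

theorem eq_zero_of_isIdempotentElem_of_trace_eq_zero [CharZero K] {A : Matrix ι ι K}
    (h : IsIdempotentElem A) (h0 : A.trace = 0) : A = 0 := by
  classical
  rw [← Matrix.trace_toLin'_eq] at h0
  exact (LinearEquiv.map_eq_zero_iff _).mp <|
    LinearMap.IsIdempotentElem.eq_zero_of_trace_eq_zero (h.map Matrix.toLinAlgEquiv') h0

theorem exists_eq_vecMulVec_of_rank_eq_one {A : Matrix ι ι K} (h : A.rank = 1) :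
    ∃ u v : ι → K, A = Matrix.vecMulVec u v := by
  classical
  obtain ⟨u, -, hu⟩ := finrank_eq_one_iff'.mp h
  choose v hv using fun j => hu ⟨A.col j, Pi.single j 1, Matrix.mulVec_single_one A j⟩
  refine ⟨u, v, Matrix.ext fun i j => ?_⟩
  rw [Matrix.vecMulVec_apply, mul_comm]
  exact (congrFun (congrArg Subtype.val (hv j)) i).symm

theorem trace_eq_of_continuousOn_isIdempotentElem {X : Type*} [TopologicalSpace X] {s : Set X}
    (hs : IsPreconnected s) {A : X → Matrix ι ι ℂ} (hA : ContinuousOn A s)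
    (h : ∀ t ∈ s, IsIdempotentElem (A t)) {x y : X} (hx : x ∈ s) (hy : y ∈ s) :
    (A x).trace = (A y).trace := by
  have hrank : ∀ t ∈ s, (A t).trace = ((A t).rank : ℂ) := fun t ht =>
    trace_eq_rank_of_isIdempotentElem (h t ht)
  have hcont : ContinuousOn (fun t => (A t).trace.re) s :=
    (Complex.continuous_re.comp continuous_id.matrix_trace).comp_continuousOn hA
  have hre : (A x).trace.re = (A y).trace.re :=
    hs.constant_of_mapsTo Nat.isClosedEmbedding_coe_real.isInducing.isDiscrete_range hcont
      (fun t ht => ⟨(A t).rank, by simp only [hrank t ht, Complex.natCast_re]⟩) hx hy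
  simp only [hrank x hx, hrank y hy, Complex.natCast_re] at hre ⊢
  exact_mod_cast hre

theorem trace_vecMulVec_eq_one {c w : ι → K} (h : Matrix.vecMulVec c w *ᵥ w = w) (hw : w ≠ 0) :
    (Matrix.vecMulVec c w).trace = 1 := by
  have hc : (w ⬝ᵥ w) • c = w := by rwa [Matrix.vecMulVec_mulVec, op_smul_eq_smul] at h
  have hww : w ⬝ᵥ w ≠ 0 := fun h0 => hw (by rw [← hc, h0, zero_smul])
  rw [Matrix.trace_vecMulVec, ← mul_right_inj' hww, mul_one, ← smul_eq_mul, ← smul_dotProduct, hc]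

end Idempotent

section Skew

variable {ι M K : Type*} {n : ℕ}

/-- A tensor, given by its components, that every permutation of the factors multiplies by its
sign. -/
def IsSkew [AddCommGroup M] (g : (Fin n → ι) → M) : Prop :=
  ∀ (σ : Equiv.Perm (Fin n)) (b : Fin n → ι), g (b ∘ σ) = Equiv.Perm.sign σ • g b

theorem isSkew_of_swap [AddCommGroup M] {g : (Fin n → ι) → M}
    (hg : ∀ (i : ℕ) (hi : i + 1 < n) (b : Fin n → ι),
      g (b ∘ Equiv.swap ⟨i, Nat.lt_of_succ_lt hi⟩ ⟨i + 1, hi⟩) = -g b) : IsSkew g := by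
  intro σ b
  cases n with
  | zero => simp [Subsingleton.elim σ 1]
  | succ n =>
    have hσ : σ ∈ Submonoid.closure (Set.range fun i : Fin n => Equiv.swap i.castSucc i.succ) := by
      rw [Equiv.Perm.mclosure_swap_castSucc_succ]
      exact Submonoid.mem_top σ
    induction hσ using Submonoid.closure_induction generalizing b with
    | mem x hx =>
      obtain ⟨i, rfl⟩ := hx
      rw [Equiv.Perm.sign_swap i.castSucc_lt_succ.ne, Units.neg_smul, one_smul]
      exact hg i (by omega) b
    | one => simp
    | mul x y _ _ hx hy =>
      rw [Equiv.Perm.coe_mul, ← Function.comp_assoc, hy, hx, Equiv.Perm.sign_mul, smul_smul,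
        mul_comm]

theorem IsSkew.eq_zero_of_not_injective [AddCommGroup M] [IsAddTorsionFree M]
    {g : (Fin n → ι) → M} (hg : IsSkew g) {b : Fin n → ι} (hb : ¬ Function.Injective b) :
    g b = 0 := by
  obtain ⟨i, j, hij, hne⟩ := Function.not_injective_iff.mp hb
  have hswap : b ∘ Equiv.swap i j = b := by
    rw [Equiv.comp_swap_eq_update, hij, Function.update_eq_self, ← hij, Function.update_eq_self]
  have hneg := hg (Equiv.swap i j) b
  rwa [hswap, Equiv.Perm.sign_swap hne, Units.neg_smul, one_smul, self_eq_neg] at hneg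

/-- The components of `e₁ ∧ ⋯ ∧ e_N` in `V^{⊗N}`. -/
def wedgeVec (K : Type*) [CommRing K] (N : ℕ) (a : Fin N → Fin N) : K :=
  ((1 : Matrix (Fin N) (Fin N) K).submatrix a id).det

variable [Field K] {N : ℕ}

theorem wedgeVec_id : wedgeVec K N id = 1 :=
  Matrix.det_one

theorem wedgeVec_ne_zero : wedgeVec K N ≠ 0 := fun h =>
  one_ne_zero (α := K) (wedgeVec_id.symm.trans (congrFun h id))

theorem isSkew_wedgeVec : IsSkew (wedgeVec K N) := fun σ a => by
  rw [Units.smul_def, zsmul_eq_mul]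
  exact Matrix.det_permute σ ((1 : Matrix (Fin N) (Fin N) K).submatrix a id)

theorem IsSkew.eq_apply_id_mul_wedgeVec [CharZero K] {g : (Fin N → Fin N) → K} (hg : IsSkew g)
    (b : Fin N → Fin N) : g b = g id * wedgeVec K N b := by
  by_cases hb : Function.Injective b
  · obtain ⟨σ, rfl⟩ : ∃ σ : Equiv.Perm (Fin N), id ∘ σ = b :=
      ⟨Equiv.ofBijective b (Finite.injective_iff_bijective.mp hb), rfl⟩
    rw [hg, isSkew_wedgeVec, wedgeVec_id, mul_smul_comm, mul_one]
  · rw [hg.eq_zero_of_not_injective hb, isSkew_wedgeVec.eq_zero_of_not_injective hb, mul_zero]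

end Skew

section Flip

open scoped Matrix

variable {N n : ℕ}

theorem twoSite_flip_apply (i j : Fin n) (a b : Fin n → Fin N) :
    twoSite i j (flip N) a b = if a = b ∘ Equiv.swap i j then 1 else 0 := by
  have hiff : ((∀ l, l ≠ i → l ≠ j → a l = b l) ∧ a i = b j ∧ a j = b i) ↔
      a = b ∘ Equiv.swap i j := by
    constructor
    · rintro ⟨hne, hi, hj⟩
      rw [Equiv.comp_swap_eq_update]
      grind
    · rintro rfl
      grind [Equiv.swap_apply_of_ne_of_ne, Equiv.swap_apply_left, Equiv.swap_apply_right]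
  simp only [twoSite, flip, Matrix.of_apply, ← ite_and, hiff]

theorem mul_twoSite_flip_apply (i j : Fin n)
    (Y : Matrix (Fin n → Fin N) (Fin n → Fin N) ℂ) (a b : Fin n → Fin N) :
    (Y * twoSite i j (flip N)) a b = Y a (b ∘ Equiv.swap i j) := by
  simp only [Matrix.mul_apply, twoSite_flip_apply, mul_ite, mul_one, mul_zero,
    Finset.sum_ite_eq', Finset.mem_univ, if_true]

theorem isRegular_of_pow_eq_one {q : ℂ} {n : ℕ} (hq : q ≠ 0)
    (h : ∀ k, 2 ≤ k → k ≤ n → q ^ (2 * k) = 1 → q ^ 2 = 1) : IsRegular q n :=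
  fun k h2 hk => qNum_ne_zero hq (by omega) (h k h2 hk)

theorem isRegular_one (n : ℕ) : IsRegular (1 : ℂ) n :=
  isRegular_of_pow_eq_one one_ne_zero fun _ _ _ _ => one_pow 2

theorem isSkew_skewElem_flip (h : IsHeckeSymmetry 1 (flip N)) (n : ℕ) (a : Fin n → Fin N) :
    IsSkew (skewElem (1 : ℂ) (generator n (flip N)) n a) := by
  refine isSkew_of_swap fun i hi b => ?_
  have heigen := (h.isHeckeRep n).skewElem_mul one_ne_zero le_rfl (isRegular_one n) hi
  rw [generator_of_lt hi] at heigen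
  simpa only [mul_twoSite_flip_apply, inv_one, neg_smul, one_smul,
    Matrix.neg_apply] using congrFun (congrFun heigen a) b

theorem skewElem_flip_eq_zero (h : IsHeckeSymmetry 1 (flip N)) (hn : N < n) :
    skewElem (1 : ℂ) (generator n (flip N)) n = 0 := by
  ext a b
  refine (isSkew_skewElem_flip h n a).eq_zero_of_not_injective fun hb => ?_
  simpa [hn.not_ge] using Fintype.card_le_of_injective b hb

theorem generator_flip_mulVec_wedgeVec {i : ℕ} (hi : i + 1 < N) :
    generator N (flip N) i *ᵥ wedgeVec ℂ N = -wedgeVec ℂ N := by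
  funext a
  have hflip : ∀ b, a = b ∘ Equiv.swap ⟨i, Nat.lt_of_succ_lt hi⟩ ⟨i + 1, hi⟩ ↔
      a ∘ Equiv.swap ⟨i, Nat.lt_of_succ_lt hi⟩ ⟨i + 1, hi⟩ = b := fun b => by
    simpa only [Equiv.symm_swap] using Equiv.eq_comp_symm (Equiv.swap _ _) a b
  simp only [generator_of_lt hi, Matrix.mulVec, dotProduct, twoSite_flip_apply, hflip, ite_mul,
    one_mul, zero_mul, Finset.sum_ite_eq, Finset.mem_univ, if_true, Pi.neg_apply]
  rw [isSkew_wedgeVec, Equiv.Perm.sign_swap (mk_ne_mk_succ hi), Units.neg_smul, one_smul]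

theorem skewElem_flip_mulVec_wedgeVec :
    skewElem (1 : ℂ) (generator N (flip N)) N *ᵥ wedgeVec ℂ N = wedgeVec ℂ N := by
  have : Nonempty (Fin N → Fin N) := ⟨id⟩
  refine Matrix.replicateCol_injective (ι := Fin N → Fin N) ?_
  rw [Matrix.replicateCol_mulVec]
  refine skewElem_mul_of_eigen (isRegular_one N) fun i hi => ?_
  rw [← Matrix.replicateCol_mulVec, generator_flip_mulVec_wedgeVec hi,
    inv_one, neg_smul, one_smul]
  rfl

theorem trace_skewElem_flip (h : IsHeckeSymmetry 1 (flip N)) :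
    (skewElem (1 : ℂ) (generator N (flip N)) N).trace = 1 := by
  have hrank : skewElem (1 : ℂ) (generator N (flip N)) N =
      Matrix.vecMulVec ((skewElem (1 : ℂ) (generator N (flip N)) N).col id) (wedgeVec ℂ N) := by
    ext a b
    exact (isSkew_skewElem_flip h N a).eq_apply_id_mul_wedgeVec b
  rw [hrank]
  exact trace_vecMulVec_eq_one (hrank ▸ skewElem_flip_mulVec_wedgeVec) wedgeVec_ne_zero

end Flip

section Deformation

variable {N : ℕ} {X : Type*} [TopologicalSpace X] {s : Set X} {p : X → ℂ}
  {S : X → Matrix (Fin N × Fin N) (Fin N × Fin N) ℂ}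

theorem continuousOn_generator (hS : ContinuousOn S s) (n i : ℕ) :
    ContinuousOn (fun t => generator n (S t) i) s := by
  unfold generator
  split_ifs with hi
  · refine continuousOn_pi.mpr fun a => continuousOn_pi.mpr fun b => ?_
    simp only [twoSite, Matrix.of_apply]
    split_ifs
    · exact continuousOn_pi.mp (continuousOn_pi.mp hS _) _
    · exact continuousOn_const
  · exact continuousOn_const

theorem continuousOn_qNum (hp : ContinuousOn p s) (hp0 : ∀ t ∈ s, p t ≠ 0) (k : ℕ) :
    ContinuousOn (fun t => qNum (p t) k) s := by
  induction k with
  | zero => exact continuousOn_const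
  | succ k ih => exact (hp.pow k).add ((hp.inv₀ hp0).mul ih)

theorem continuousOn_smul_one_sub_smul_generator (hp : ContinuousOn p s) (hp0 : ∀ t ∈ s, p t ≠ 0)
    (hS : ContinuousOn S s) (n k i : ℕ) :
    ContinuousOn (fun t => p t ^ k • 1 - qNum (p t) k • generator n (S t) i) s :=
  ((hp.pow k).smul continuousOn_const).sub
    ((continuousOn_qNum hp hp0 k).smul (continuousOn_generator hS n i))

theorem continuousOn_skewElem (hp : ContinuousOn p s) (hp0 : ∀ t ∈ s, p t ≠ 0)
    (hS : ContinuousOn S s) (n k : ℕ) (hreg : ∀ t ∈ s, IsRegular (p t) k) :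
    ContinuousOn (fun t => skewElem (p t) (generator n (S t)) k) s := by
  induction k using Nat.twoStepInduction with
  | zero | one => exact continuousOn_const
  | more k _ ih =>
    have hA := ih fun t ht => (hreg t ht).mono (by omega)
    have hinv := (continuousOn_qNum hp hp0 (k + 2)).inv₀ fun t ht => hreg t ht _ (by omega) le_rfl
    exact hinv.smul
      ((hA.mul (continuousOn_smul_one_sub_smul_generator hp hp0 hS n (k + 1) k)).mul hA)

theorem trace_skewElem_eq_of_isPreconnected (hs : IsPreconnected s) (hp : ContinuousOn p s)
    (hS : ContinuousOn S s) (hH : ∀ t ∈ s, IsHeckeSymmetry (p t) (S t)) {n : ℕ}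
    (hreg : ∀ t ∈ s, IsRegular (p t) n) {x y : X} (hx : x ∈ s) (hy : y ∈ s) :
    (skewElem (p x) (generator n (S x)) n).trace = (skewElem (p y) (generator n (S y)) n).trace :=
  have hp0 : ∀ t ∈ s, p t ≠ 0 := fun t ht => (hH t ht).ne_zero
  trace_eq_of_continuousOn_isIdempotentElem hs (continuousOn_skewElem hp hp0 hS n n hreg)
    (fun t ht => ((hH t ht).isHeckeRep n).skewElem_mul_self (hp0 t ht) le_rfl (hreg t ht)) hx hy

theorem skewElem_eq_zero_of_isPreconnected (hs : IsPreconnected s) (hp : ContinuousOn p s)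
    (hS : ContinuousOn S s) (hH : ∀ t ∈ s, IsHeckeSymmetry (p t) (S t)) {n : ℕ} (hn : N < n)
    (hreg : ∀ t ∈ s, IsRegular (p t) n) {x y : X} (hx : x ∈ s) (hpx : p x = 1)
    (hSx : S x = flip N) (hy : y ∈ s) : skewElem (p y) (generator n (S y)) n = 0 := by
  refine eq_zero_of_isIdempotentElem_of_trace_eq_zero
    (((hH y hy).isHeckeRep n).skewElem_mul_self (hH y hy).ne_zero le_rfl (hreg y hy)) ?_
  have hflip := hH x hx
  rw [hpx, hSx] at hflip
  rw [trace_skewElem_eq_of_isPreconnected hs hp hS hH hreg hy hx, hpx, hSx,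
    skewElem_flip_eq_zero hflip hn, Matrix.trace_zero]

end Deformation

section DeformationOfFlip

open Set

variable {N : ℕ} {q : ℂ}

theorem isRegular_of_mem_Icc {p : ℝ → ℂ} (hp0 : ∀ t ∈ Icc (0 : ℝ) 1, p t ≠ 0)
    (hgen : ∀ t ∈ Ico (0 : ℝ) 1, ∀ k, 2 ≤ k → k ≤ N + 1 → p t ^ (2 * k) = 1 → p t ^ 2 = 1)
    (hreg : IsRegular (p 1) N) : ∀ t ∈ Icc (0 : ℝ) 1, IsRegular (p t) N := by
  intro t ht
  rcases ht.2.lt_or_eq with h1 | rfl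
  · exact isRegular_of_pow_eq_one (hp0 t ht) fun k h2 hk => hgen t ⟨ht.1, h1⟩ k h2 (by omega)
  · exact hreg

theorem IsDeformationOfFlip.trace_skewElem {R : Matrix (Fin N × Fin N) (Fin N × Fin N) ℂ}
    (h : IsDeformationOfFlip q R) (hreg : IsRegular q N) :
    (skewElem q (generator N R) N).trace = 1 := by
  obtain ⟨p, S, hp, hS, hH, hgen, hp0, hS0, rfl, rfl⟩ := h
  have hflip := hH 0 (left_mem_Icc.mpr zero_le_one)
  rw [hp0, hS0] at hflip
  rw [trace_skewElem_eq_of_isPreconnected isPreconnected_Icc hp hS hH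
    (isRegular_of_mem_Icc (fun t ht => (hH t ht).ne_zero) hgen hreg)
    (right_mem_Icc.mpr zero_le_one) (left_mem_Icc.mpr zero_le_one), hp0, hS0,
    trace_skewElem_flip hflip]

/- The element is `(N + 1)_q A^{(N+1)}`. At the end of the deformation `(N + 1)_q` may vanish, so
`A^{(N+1)} = 0` holds only before the end, and it is this multiple that passes to the limit. -/
theorem IsDeformationOfFlip.skewElem_mul_mul_skewElem
    {R : Matrix (Fin (N + 1) × Fin (N + 1)) (Fin (N + 1) × Fin (N + 1)) ℂ}
    (h : IsDeformationOfFlip q R) (hreg : IsRegular q (N + 1)) :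
    skewElem q (generator (N + 2) R) (N + 1) *
      (q ^ (N + 1) • 1 - qNum q (N + 1) • generator (N + 2) R N) *
        skewElem q (generator (N + 2) R) (N + 1) = 0 := by
  obtain ⟨p, S, hp, hS, hH, hgen, hp0, hS0, rfl, rfl⟩ := h
  have hne : ∀ t ∈ Icc (0 : ℝ) 1, p t ≠ 0 := fun t ht => (hH t ht).ne_zero
  have hsub : Ico (0 : ℝ) 1 ⊆ Icc 0 1 := Ico_subset_Icc_self
  have hreg' : ∀ t ∈ Ico (0 : ℝ) 1, IsRegular (p t) (N + 2) := fun t ht =>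
    isRegular_of_pow_eq_one (hne t (hsub ht)) (hgen t ht)
  have hA := continuousOn_skewElem hp hne hS (N + 2) (N + 1) (isRegular_of_mem_Icc hne hgen hreg)
  have hE := continuousOn_smul_one_sub_smul_generator hp hne hS (N + 2) (N + 1) N
  refine EqOn.of_subset_closure (s := Ico (0 : ℝ) 1) (g := fun _ => 0) (fun t ht => ?_)
    ((hA.mul hE).mul hA) continuousOn_const hsub (closure_Ico zero_ne_one).ge
    (right_mem_Icc.mpr zero_le_one)
  have hzero : skewElem (p t) (generator (N + 2) (S t)) (N + 2) = 0 :=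
    skewElem_eq_zero_of_isPreconnected isPreconnected_Ico (hp.mono hsub) (hS.mono hsub)
      (fun t ht => hH t (hsub ht)) (Nat.lt_succ_self _) hreg' (left_mem_Ico.mpr zero_lt_one) hp0
      hS0 ht
  rw [skewElem_add_two] at hzero
  exact (smul_eq_zero.mp hzero).resolve_left (inv_ne_zero (hreg' t ht _ (by omega) le_rfl))

end DeformationOfFlip

section TraceSkewElem

open scoped Kronecker

variable {N : ℕ} {q : ℂ} {R : Matrix (Fin N × Fin N) (Fin N × Fin N) ℂ}
  {C : Matrix (Fin N) (Fin N) ℂ}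

theorem commute_tensorPower_skewElem (hCR : Commute (C ⊗ₖ C) R) {n k : ℕ} (hk : k ≤ n) :
    Commute (tensorPower n C) (skewElem q (generator n R) k) :=
  commute_skewElem fun i hi => by
    rw [generator_of_lt (hi.trans_le hk)]
    exact commute_tensorPower_twoSite C hCR (mk_ne_mk_succ _)

theorem partialTrace_skewElem_mul_mul_skewElem (hR : IsHeckeSymmetry q R)
    (hC : traceSecond C R = 1) {k : ℕ} (hreg : IsRegular q (k + 1)) :
    partialTrace C (skewElem q (generator (k + 2) R) (k + 1) *
      (q ^ (k + 1) • 1 - qNum q (k + 1) • generator (k + 2) R k) *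
        skewElem q (generator (k + 2) R) (k + 1)) =
      (q ^ (k + 1) * C.trace - qNum q (k + 1)) • skewElem q (generator (k + 1) R) (k + 1) := by
  rw [← sites_castLE_skewElem (Nat.le_succ (k + 1)) le_rfl, partialTrace_mul_sites,
    partialTrace_sites_mul, map_sub, map_smul, map_smul, partialTrace_one,
    partialTrace_generator hC, smul_smul, ← sub_smul, mul_smul_comm, mul_one, smul_mul_assoc,
    (hR.isHeckeRep (k + 1)).skewElem_mul_self hR.ne_zero le_rfl hreg]

theorem IsDeformationOfFlip.trace_eq (h : IsDeformationOfFlip q R) (hR : IsHeckeSymmetry q R)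
    (hC : traceSecond C R = 1) (hreg : IsRegular q N) : C.trace = (q ^ N)⁻¹ * qNum q N := by
  cases N with
  | zero => rw [qNum_zero, mul_zero, Matrix.trace, Finset.univ_eq_empty, Finset.sum_empty]
  | succ k =>
    have hA : skewElem q (generator (k + 1) R) (k + 1) ≠ 0 := fun h0 => by
      simpa [h0] using h.trace_skewElem hreg
    have hpartial := partialTrace_skewElem_mul_mul_skewElem hR hC hreg
    rw [h.skewElem_mul_mul_skewElem hreg, map_zero] at hpartial
    rw [eq_inv_mul_iff_mul_eq₀ (pow_ne_zero _ hR.ne_zero)]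
    exact sub_eq_zero.mp ((smul_eq_zero.mp hpartial.symm).resolve_right hA)

theorem qNum_succ_mul_trace_tensorPower_mul_skewElem (hR : IsHeckeSymmetry q R)
    (hC : traceSecond C R = 1) {k : ℕ} (hreg : IsRegular q (k + 1)) :
    qNum q (k + 1) * (tensorPower (k + 1) C * skewElem q (generator (k + 1) R) (k + 1)).trace =
      (q ^ k * C.trace - qNum q k) *
        (tensorPower k C * skewElem q (generator k R) k).trace := by
  rw [trace_tensorPower_succ_mul]
  cases k with
  | zero => simp [partialTrace_one, skewElem, qNum_one]
  | succ k =>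
    rw [skewElem_add_two, map_smul,
      partialTrace_skewElem_mul_mul_skewElem hR hC (hreg.mono (by omega)), mul_smul_comm,
      mul_smul_comm, Matrix.trace_smul, Matrix.trace_smul, smul_eq_mul, smul_eq_mul,
      mul_inv_cancel_left₀ (hreg _ (by omega) le_rfl)]

theorem trace_tensorPower_mul_skewElem_mul_prod (hR : IsHeckeSymmetry q R)
    (hC : traceSecond C R = 1) {n : ℕ} (htr : C.trace = (q ^ n)⁻¹ * qNum q n) {k : ℕ}
    (hreg : IsRegular q k) (hk : k ≤ n) :
    (tensorPower k C * skewElem q (generator k R) k).trace *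
        ∏ j ∈ Finset.range k, qNum q (j + 1) =
      (q ^ (n * k))⁻¹ * ∏ j ∈ Finset.range k, qNum q (n - j) := by
  have hq := hR.ne_zero
  induction k with
  | zero => simp [skewElem, tensorPower, Matrix.trace]
  | succ k ih =>
    have hfactor : q ^ k * C.trace - qNum q k = (q ^ n)⁻¹ * qNum q (n - k) := by
      obtain ⟨m, rfl⟩ := Nat.exists_eq_add_of_le (Nat.le_of_succ_le hk)
      rw [htr, Nat.add_sub_cancel_left, qNum_add hq, pow_add]
      field_simp
      ring
    calc _ = (q ^ k * C.trace - qNum q k) *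
          ((tensorPower k C * skewElem q (generator k R) k).trace *
            ∏ j ∈ Finset.range k, qNum q (j + 1)) := by
          rw [← mul_assoc, ← qNum_succ_mul_trace_tensorPower_mul_skewElem hR hC hreg,
            Finset.prod_range_succ]
          ring
      _ = _ := by
          rw [ih (hreg.mono k.le_succ) (Nat.le_of_succ_le hk), hfactor, Finset.prod_range_succ,
            Nat.mul_succ, pow_add, mul_inv]
          ring

theorem trace_tensorPower_mul_skewElem_self (hR : IsHeckeSymmetry q R)
    (hC : traceSecond C R = 1) {n : ℕ} (htr : C.trace = (q ^ n)⁻¹ * qNum q n)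
    (hreg : IsRegular q n) :
    (tensorPower n C * skewElem q (generator n R) n).trace = (q ^ (n * n))⁻¹ := by
  have hreflect : ∏ j ∈ Finset.range n, qNum q (n - j) = ∏ j ∈ Finset.range n, qNum q (j + 1) := by
    rw [← Finset.prod_range_reflect]
    refine Finset.prod_congr rfl fun j hj => ?_
    have := Finset.mem_range.mp hj
    congr 1
    omega
  have hprod : ∏ j ∈ Finset.range n, qNum q (j + 1) ≠ 0 := by
    refine Finset.prod_ne_zero_iff.mpr fun j hj => ?_
    rcases j with _ | j
    · simp [qNum_one]
    · exact hreg _ (by omega) (Finset.mem_range.mp hj)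
  refine mul_right_cancel₀ hprod ?_
  rw [trace_tensorPower_mul_skewElem_mul_prod hR hC htr hreg le_rfl, hreflect]

end TraceSkewElem

section Sandwich

open scoped Matrix

variable {ι 𝒜 : Type*} [Ring 𝒜] [Algebra ℂ 𝒜]

theorem scalarMat_smul (c : ℂ) (X : Matrix ι ι ℂ) : scalarMat 𝒜 (c • X) = c • scalarMat 𝒜 X :=
  Matrix.ext fun a b => map_smul (Algebra.ofId ℂ 𝒜) c (X a b)

theorem trace_scalarMat_mul_comm [Fintype ι] (X : Matrix ι ι ℂ) (Y : Matrix ι ι 𝒜) :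
    (scalarMat 𝒜 X * Y).trace = (Y * scalarMat 𝒜 X).trace := by
  simp only [Matrix.trace, Matrix.diag_apply, Matrix.mul_apply, scalarMat, Matrix.map_apply,
    Algebra.commutes]
  exact Finset.sum_comm

theorem mul_vecMulVec_eq_trace_smul [Fintype ι] {K : Matrix ι ι ℂ} {u v : ι → ℂ}
    (huv : v ⬝ᵥ u = 1) (hK : Commute K (Matrix.vecMulVec u v)) :
    K * Matrix.vecMulVec u v = (K * Matrix.vecMulVec u v).trace • Matrix.vecMulVec u v := by
  have htrace : (K * Matrix.vecMulVec u v).trace = v ⬝ᵥ (K *ᵥ u) := by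
    rw [Matrix.mul_vecMulVec, Matrix.trace_vecMulVec, dotProduct_comm]
  calc K * Matrix.vecMulVec u v = K * Matrix.vecMulVec u v * Matrix.vecMulVec u v := by
        rw [mul_assoc, Matrix.vecMulVec_mul_vecMulVec, huv, one_smul]
    _ = Matrix.vecMulVec u v * (K * Matrix.vecMulVec u v) := by rw [hK.eq, mul_assoc, hK.eq]
    _ = _ := by
        rw [htrace, Matrix.mul_vecMulVec, Matrix.vecMulVec_mul_vecMulVec, Matrix.vecMulVec_smul]

variable {N n : ℕ} {u v : (Fin n → Fin N) → ℂ} {X Y : Matrix (Fin n → Fin N) (Fin n → Fin N) 𝒜}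

theorem sandwich_eq_trace (v u : (Fin n → Fin N) → ℂ)
    (Y : Matrix (Fin n → Fin N) (Fin n → Fin N) 𝒜) :
    sandwich v u Y = (scalarMat 𝒜 (Matrix.vecMulVec u v) * Y).trace := by
  simp only [sandwich, Matrix.trace, Matrix.diag_apply, Matrix.mul_apply, scalarMat,
    Matrix.map_apply, Matrix.vecMulVec_apply, ← Algebra.smul_def]
  rw [Finset.sum_comm]
  simp only [mul_comm]

theorem sandwich_smul (c : ℂ) : sandwich v u (c • Y) = c • sandwich v u Y := by
  simp only [sandwich_eq_trace, mul_smul_comm, Matrix.trace_smul]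

theorem scalarMat_vecMulVec_mul_mul (v u : (Fin n → Fin N) → ℂ)
    (Y : Matrix (Fin n → Fin N) (Fin n → Fin N) 𝒜) :
    scalarMat 𝒜 (Matrix.vecMulVec u v) * Y * scalarMat 𝒜 (Matrix.vecMulVec u v) =
      sandwich v u Y • scalarMat 𝒜 (Matrix.vecMulVec u v) := by
  ext a b
  simp only [Matrix.mul_apply, Matrix.smul_apply, scalarMat, Matrix.map_apply,
    Matrix.vecMulVec_apply, sandwich, Finset.sum_mul, smul_eq_mul]
  rw [Finset.sum_comm]
  refine Finset.sum_congr rfl fun c _ => Finset.sum_congr rfl fun d _ => ?_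
  simp only [← Algebra.smul_def, ← Algebra.commutes, smul_smul]
  congr 1
  ring

theorem scalarMat_vecMulVec_mul_self (huv : v ⬝ᵥ u = 1) :
    scalarMat 𝒜 (Matrix.vecMulVec u v) * scalarMat 𝒜 (Matrix.vecMulVec u v) =
      scalarMat 𝒜 (Matrix.vecMulVec u v) := by
  rw [← scalarMat_mul, Matrix.vecMulVec_mul_vecMulVec, huv, one_smul]

theorem sandwich_mul_scalarMat_vecMulVec (huv : v ⬝ᵥ u = 1) :
    sandwich v u (Y * scalarMat 𝒜 (Matrix.vecMulVec u v)) = sandwich v u Y := by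
  rw [sandwich_eq_trace, trace_scalarMat_mul_comm, mul_assoc, scalarMat_vecMulVec_mul_self huv,
    ← trace_scalarMat_mul_comm, ← sandwich_eq_trace]

theorem sandwich_mul (huv : v ⬝ᵥ u = 1) (hX : Commute X (scalarMat 𝒜 (Matrix.vecMulVec u v))) :
    sandwich v u (X * Y) = sandwich v u X * sandwich v u Y := by
  set A := scalarMat 𝒜 (Matrix.vecMulVec u v) with hA
  have hconj : A * (X * Y) = A * X * A * Y := by
    rw [← hX.eq, mul_assoc X, scalarMat_vecMulVec_mul_self huv, ← hA, hX.eq, mul_assoc]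
  rw [sandwich_eq_trace, ← hA, hconj, scalarMat_vecMulVec_mul_mul, ← hA, smul_mul_assoc,
    Matrix.trace_smul, smul_eq_mul, sandwich_eq_trace v u Y]

theorem rTrace_scalarMat_vecMulVec_mul {Ψ : Matrix (Fin N × Fin N) (Fin N × Fin N) ℂ}
    (huv : v ⬝ᵥ u = 1)
    (hC : Commute (tensorPower n (traceMatrix Ψ)) (Matrix.vecMulVec u v)) :
    rTrace Ψ (scalarMat 𝒜 (Matrix.vecMulVec u v) * Y) =
      (tensorPower n (traceMatrix Ψ) * Matrix.vecMulVec u v).trace • sandwich v u Y := by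
  change (scalarMat 𝒜 (tensorPower n (traceMatrix Ψ)) * _).trace = _
  rw [← mul_assoc, ← scalarMat_mul, mul_vecMulVec_eq_trace_smul huv hC, scalarMat_smul,
    smul_mul_assoc, Matrix.trace_smul, ← sandwich_eq_trace,
    ← mul_vecMulVec_eq_trace_smul huv hC]

end Sandwich

section Capelli

variable {N n : ℕ} {q : ℂ} {R Ψ : Matrix (Fin N × Fin N) (Fin N × Fin N) ℂ}

theorem commute_prod_overlineCopy_matM (hR : IsHeckeSymmetry q R) :
    Commute (List.ofFn fun k : Fin n => overlineCopy R (matM R) n k k.isLt).prod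
      (scalarMat (QuantumDouble R) (skewElem q (generator n R) n)) := by
  have hskew : scalarMat (QuantumDouble R) (skewElem q (generator n R) n) =
      skewElem q (fun i => scalarMat (QuantumDouble R) (generator n R i)) n :=
    map_skewElem (Algebra.ofId ℂ (QuantumDouble R)).mapMatrix q (generator n R) n
  rw [hskew]
  refine commute_skewElem fun i hi => ?_
  have hcomm := (isDouble_quantumDouble hR (by omega)).commute_incProd_copy hi le_rfl hi.ne
  rw [← prod_ofFn_eq_incProd] at hcomm
  simpa only [overlineCopy_eq_copy hR, val_generatorUnit] using hcomm.symm

/-- The product `capelliProduct` in `n` factors, with the `q`-integers `qNum` in place of `qInt`, so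
that it is meaningful at `q = ±1` too. -/
noncomputable def capelliElem (q : ℂ) (R : Matrix (Fin N × Fin N) (Fin N × Fin N) ℂ) (n : ℕ) :
    Matrix (Fin n → Fin N) (Fin n → Fin N) (QuantumDouble R) :=
  (List.ofFn fun k : Fin n => overlineCopy R (matL R) n k k.isLt +
    (q ^ (k : ℕ) * qNum q k) • (1 : Matrix _ _ (QuantumDouble R))).prod

theorem capelliProduct_eq_capelliElem (hq : q ≠ 0) (hq2 : q ^ 2 ≠ 1) :
    capelliProduct q R = capelliElem q R N := by
  rw [capelliProduct, capelliElem, qInt_eq_qNum hq hq2]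

theorem capelliElem_mul (hR : IsHeckeSymmetry q R)
    {b : Matrix (Fin n → Fin N) (Fin n → Fin N) (QuantumDouble R)}
    (hb : ∀ i, i + 1 < n →
      scalarMat (QuantumDouble R) (generator n R i) * b = (-q⁻¹) • b) :
    capelliElem q R n * b =
      q ^ (n * (n - 1)) •
        ((List.ofFn fun k : Fin n => overlineCopy R (matM R) n k k.isLt).prod *
          ((List.ofFn fun k : Fin n => overlineCopy R (matD R) n k k.isLt).reverse.prod * b)) := by
  cases n with
  | zero => simp [capelliElem]
  | succ n =>
    have hcapelli := (isDouble_quantumDouble hR n.succ_pos).capelli hR.ne_zero le_rfl hb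
    rw [← prod_ofFn_eq_incProd, ← prod_ofFn_eq_incProd, ← prod_reverse_ofFn_eq_decProd]
      at hcapelli
    simpa only [capelliElem, overlineCopy_eq_copy hR, matL, oneSite_mul] using hcapelli

theorem sandwich_capelliElem (hR : IsHeckeSymmetry q R) (hreg : IsRegular q N)
    {u v : (Fin N → Fin N) → ℂ} (hA : skewElem q (generator N R) N = Matrix.vecMulVec u v)
    (huv : v ⬝ᵥ u = 1) :
    sandwich v u (capelliElem q R N) =
      q ^ (N * (N - 1)) • (detM R u v * detD R u v) := by
  have hM := commute_prod_overlineCopy_matM (n := N) hR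
  rw [hA] at hM
  have heigen : ∀ i, i + 1 < N →
      scalarMat (QuantumDouble R) (generator N R i) *
          scalarMat (QuantumDouble R) (Matrix.vecMulVec u v) =
        (-q⁻¹) • scalarMat (QuantumDouble R) (Matrix.vecMulVec u v) := fun i hi => by
    rw [← hA, ← scalarMat_mul, (hR.isHeckeRep N).mul_skewElem hR.ne_zero le_rfl hreg hi,
      scalarMat_smul]
  rw [← sandwich_mul_scalarMat_vecMulVec huv, capelliElem_mul hR heigen, sandwich_smul,
    sandwich_mul huv hM, sandwich_mul_scalarMat_vecMulVec huv, detM, detD]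

end Capelli

end Capelli

theorem corollary6_general {N : ℕ} {q : ℂ}
    {R Ψ : Matrix (Fin N × Fin N) (Fin N × Fin N) ℂ} (hreg : Capelli.IsRegular q N)
    (hR : Capelli.IsHeckeSymmetry q R) (hΨ : Capelli.IsSkewInverse R Ψ)
    (hdef : Capelli.IsDeformationOfFlip q R) :
    (Capelli.skewElem q (Capelli.generator N R) N).rank = 1 ∧
    (∃ u v : (Fin N → Fin N) → ℂ,
      Capelli.skewElem q (Capelli.generator N R) N = Matrix.vecMulVec u v ∧ v ⬝ᵥ u = 1) ∧
    ∀ u v : (Fin N → Fin N) → ℂ,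
      Capelli.skewElem q (Capelli.generator N R) N = Matrix.vecMulVec u v → v ⬝ᵥ u = 1 →
      Capelli.rTrace Ψ
          (Capelli.scalarMat (Capelli.QuantumDouble R)
              (Capelli.skewElem q (Capelli.generator N R) N) *
            Capelli.capelliElem q R N) =
        (q ^ N)⁻¹ • (Capelli.detM R u v * Capelli.detD R u v) := by
  have htrace := hdef.trace_skewElem hreg
  have hrank : (Capelli.skewElem q (Capelli.generator N R) N).rank = 1 := by
    have hidem := (hR.isHeckeRep N).skewElem_mul_self hR.ne_zero le_rfl hreg
    exact_mod_cast (Capelli.trace_eq_rank_of_isIdempotentElem hidem).symm.trans htrace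
  refine ⟨hrank, ?_, fun u v hA huv => ?_⟩
  · obtain ⟨u, v, hA⟩ := Capelli.exists_eq_vecMulVec_of_rank_eq_one hrank
    exact ⟨u, v, hA, by rwa [hA, Matrix.trace_vecMulVec, dotProduct_comm] at htrace⟩
  · have hC := hΨ.traceSecond_traceMatrix
    have hCA := Capelli.commute_tensorPower_skewElem (q := q)
      (Capelli.commute_kronecker hR hΨ.traceSecond_injective hC) (le_refl N)
    have htraceCA :=
      Capelli.trace_tensorPower_mul_skewElem_self hR hC (hdef.trace_eq hR hC hreg) hreg
    have hexp : N * N = N + N * (N - 1) := by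
      cases N with
      | zero => rfl
      | succ N => rw [Nat.add_sub_cancel]; ring
    rw [hA] at hCA htraceCA ⊢
    rw [Capelli.rTrace_scalarMat_vecMulVec_mul huv hCA, htraceCA,
      Capelli.sandwich_capelliElem hR hreg hA huv, smul_smul, hexp, pow_add, mul_inv,
      inv_mul_cancel_right₀ (pow_ne_zero _ hR.ne_zero)]

theorem corollary6 (N : ℕ) (q : ℂ) (hq : q ^ 2 ≠ 1)
    (hqk : ∀ k : ℕ, 2 ≤ k → k ≤ N → q ^ (2 * k) ≠ 1)
    (R Ψ : Matrix (Fin N × Fin N) (Fin N × Fin N) ℂ)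
    (hR : Capelli.IsHeckeSymmetry q R)
    (hΨ : Capelli.IsSkewInverse R Ψ)
    (hdef : Capelli.IsDeformationOfFlip q R) :
    (Capelli.skewSymm q R N N le_rfl).rank = 1 ∧
    (∃ u v : (Fin N → Fin N) → ℂ,
      Capelli.skewSymm q R N N le_rfl = Matrix.vecMulVec u v ∧ v ⬝ᵥ u = 1) ∧
    ∀ u v : (Fin N → Fin N) → ℂ,
      Capelli.skewSymm q R N N le_rfl = Matrix.vecMulVec u v → v ⬝ᵥ u = 1 →
      Capelli.rTrace Ψ
          (Capelli.scalarMat (Capelli.QuantumDouble R) (Capelli.skewSymm q R N N le_rfl) *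
            Capelli.capelliProduct q R) =
        (q ^ N)⁻¹ • (Capelli.detM R u v * Capelli.detD R u v) := by
  rw [Capelli.skewSymm_eq_skewElem hR.ne_zero hq,
    Capelli.capelliProduct_eq_capelliElem hR.ne_zero hq]
  exact corollary6_general (Capelli.isRegular_of_pow_eq_one hR.ne_zero fun k h2 hk h =>
    absurd h (hqk k h2 hk)) hR hΨ hdef
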